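/- Manifolds are smooth, Hausdorff and possibly with boundary; no orientability is assumed. For a space $X$ let $b_1(X)$ denote the rank of $H_1(X;\mathbb{Z})$. A connect sum decomposition $M = A \# B$ of a $3$-manifold $M$ into $3$-manifolds $A$ and $B$ means that $M$ is obtained from the disjoint union of $A$ and $B$ by removing from the interior of $A$ an open ball $V_A$, and from the interior of $B$ an open ball $V_B$, whose closures are smoothly embedded closed balls, and gluing the complements $A \setminus V_A$ and $B \setminus V_B$ together along their boundary spheres $\partial V_A$ and $\partial V_B$ by a diffeomorphism $\phi : \partial V_A \to \partial V_B$. The index of a covering space is the number of points in each fibre, and a connected covering space with finite index is nontrivial if its index is at least $2$. Let $M$ be a compact connected $3$-manifold. Suppose that $A \# B$ is a connect sum decomposition of $M$ such that $b_1(A) \geq 1$ and $B$ has a nontrivial connected covering space with finite index. Then there exist a connected covering space $\tilde M$ of $M$ with finite index, equipped with the smooth structure for which the covering projection is a local diffeomorphism, and a smoothly embedded $2$-sphere $\Sigma$ in the interior of $\tilde M$ such that $b_1(\tilde M) \geq 2$ and $\Sigma$ is nonseparating, i.e. $\tilde M \setminus \Sigma$ is connected. -/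

import Mathlib

open scoped Manifold ContDiff EuclideanSpace

universe u

/-- Euclidean 3-space. -/
abbrev E3 : Type := EuclideanSpace ℝ (Fin 3)

/-- The standard smooth 2-sphere, the unit sphere of Euclidean 3-space. -/
abbrev S2 : Type := Metric.sphere (0 : E3) 1

/-- The first singular homology group `H₁(X; ℤ)`. -/
noncomputable def singularH1 (X : Type u) [TopologicalSpace X] : ModuleCat.{u} ℤ :=
  ((AlgebraicTopology.singularHomologyFunctor (ModuleCat.{u} ℤ) 1).obj
    (ModuleCat.of ℤ (ULift.{u} ℤ))).obj (TopCat.of X)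

/-- The first Betti number `b₁(X)`, the rank of the abelian group `H₁(X; ℤ)`. It is a cardinal,
so that no default value enters when the rank is infinite. -/
noncomputable def bettiOne (X : Type u) [TopologicalSpace X] : Cardinal.{u} :=
  Module.rank ℤ (singularH1 X)

/-- `p : E → X` is a connected covering space of `X` with finite index `n`: the total space is
connected (in particular nonempty), and every fibre has exactly `n` points, where `n` is a positive
natural number. The covering space is trivial when `n = 1` and nontrivial when `2 ≤ n`. -/
structure IsConnectedCovering {E X : Type*} [TopologicalSpace E] [TopologicalSpace X]
    (p : E → X) (n : ℕ) : Prop where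
  connected : ConnectedSpace E
  isCoveringMap : IsCoveringMap p
  index_pos : 0 < n
  card_fiber : ∀ x : X, Nat.card (p ⁻¹' {x}) = n

/-- `c : ℝ³ → A` is a diffeomorphism onto an open subset of the 3-manifold `A`. The image of the
closed unit ball is then a smooth closed ball in the interior of `A`. -/
structure IsBallChart {A : Type*} [TopologicalSpace A] [ChartedSpace (EuclideanHalfSpace 3) A]
    (c : E3 → A) : Prop where
  isOpenEmbedding : Topology.IsOpenEmbedding c
  isLocalDiffeomorph : IsLocalDiffeomorph (𝓡 3) (𝓡∂ 3) ∞ c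

/-- `f` restricts to a diffeomorphism from the subset `s` of the 3-manifold `A` onto the subset
`f '' s` of the 3-manifold `M`. -/
def IsDiffeoOnImage {A M : Type*} [TopologicalSpace A] [ChartedSpace (EuclideanHalfSpace 3) A]
    [TopologicalSpace M] [ChartedSpace (EuclideanHalfSpace 3) M] (f : A → M) (s : Set A) : Prop :=
  ContMDiffOn (𝓡∂ 3) (𝓡∂ 3) ∞ f s ∧
    ∃ g : M → A, Set.LeftInvOn g f s ∧ ContMDiffOn (𝓡∂ 3) (𝓡∂ 3) ∞ g (f '' s)

/-- A connect sum decomposition `M = A # B`: an open ball `V_A` (with smooth closure) is removed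
from the interior of `A`, an open ball `V_B` from the interior of `B`, and `M` is the result of
gluing `A \ V_A` to `B \ V_B` along a diffeomorphism `φ : ∂V_A → ∂V_B`. The two boundary spheres
are parametrized by the unit sphere. The functions `inclA`, `inclB` matter only on `A \ V_A` and
`B \ V_B`. No orientation is involved, and the manifolds may have boundary. -/
structure ConnectSumDecomposition (A B M : Type u)
    [TopologicalSpace A] [ChartedSpace (EuclideanHalfSpace 3) A]
    [TopologicalSpace B] [ChartedSpace (EuclideanHalfSpace 3) B]
    [TopologicalSpace M] [ChartedSpace (EuclideanHalfSpace 3) M] where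
  /-- the chart of `A` whose open unit ball is `V_A` -/
  ballA : E3 → A
  isBallChart_ballA : IsBallChart ballA
  /-- the chart of `B` whose open unit ball is `V_B` -/
  ballB : E3 → B
  isBallChart_ballB : IsBallChart ballB
  /-- the gluing diffeomorphism `∂V_A → ∂V_B` -/
  φ : S2 ≃ₘ^∞⟮𝓡 2, 𝓡 2⟯ S2
  /-- the inclusion of `A \ V_A` into `M` -/
  inclA : A → M
  /-- the inclusion of `B \ V_B` into `M` -/
  inclB : B → M
  isDiffeoOnImage_inclA : IsDiffeoOnImage inclA (ballA '' Metric.ball 0 1)ᶜ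
  isDiffeoOnImage_inclB : IsDiffeoOnImage inclB (ballB '' Metric.ball 0 1)ᶜ
  isClosed_imageA : IsClosed (inclA '' (ballA '' Metric.ball 0 1)ᶜ)
  isClosed_imageB : IsClosed (inclB '' (ballB '' Metric.ball 0 1)ᶜ)
  cover : inclA '' (ballA '' Metric.ball 0 1)ᶜ ∪ inclB '' (ballB '' Metric.ball 0 1)ᶜ = Set.univ
  /-- the only identifications between the two pieces are those prescribed by `φ` -/
  glue : ∀ a ∈ (ballA '' Metric.ball 0 1)ᶜ, ∀ b ∈ (ballB '' Metric.ball 0 1)ᶜ,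
    (inclA a = inclB b ↔ ∃ x : S2, a = ballA x ∧ b = ballB (φ x))

/-- `σ` is a smooth embedding of the 2-sphere into the interior of the 3-manifold `M`. -/
structure IsEmbeddedSphere {M : Type*} [TopologicalSpace M] [ChartedSpace (EuclideanHalfSpace 3) M]
    (σ : S2 → M) : Prop where
  isSmoothEmbedding : Manifold.IsSmoothEmbedding (𝓡 2) (𝓡∂ 3) ∞ σ
  mem_interior : ∀ x, σ x ∈ (𝓡∂ 3).interior M

/-- The sphere `σ` is nonseparating in `M`: the complement of its image is connected. -/
def IsNonseparating {M : Type*} [TopologicalSpace M] (σ : S2 → M) : Prop :=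
  IsConnected (Set.range σ)ᶜ

/-!
Let `f : A → ℝ/ℤ` be a map to the circle and `q : B' → B` a covering of index `n ≥ 2`. Collapsing
the side of `B` to a point gives a pinch map `M → A`, collapsing the side of `A` gives `M → B`, and
the covering `M'` of `M` is the pullback, along `(f ∘ pinch, pinch) : M → ℝ/ℤ × B`, of the product
of the triple cover `s ↦ 3 • s` of the circle and of `q` (`PinchCover`, `IsCoveringMap.prodMap`,
`IsCoveringMap.pullback_fst`). It has index `3 * n`. Over the side of `A` it consists of `n` copies
of the triple cover `{(a, s) | f a = 3 • s}` of `A`, each with three open balls removed; over the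
side of `B` it consists of three copies of `B'`, each with `n` open balls removed. The pieces are
glued along spheres, one for each pair of pieces from different sides, so that they form the complete
bipartite graph `K_{n,3}`.

The copies of `B'` are connected, and the triple cover of `A` is connected if `f` is not three times
another map to the circle (`preconnectedSpace_tripleCover`). Such an `f` exists because
`b₁(A) ≥ 1` (`exists_circleMap_not_three_nsmul`): a rational cocycle on paths that is not a
coboundary has local primitives; after clearing denominators these differ by integers, and a
partition of unity glues them to a map to the circle that is not null-homotopic; a map with
the smallest nonzero winding number on a suitable closed curve is not divisible by three.

Fix a copy `b₀` of the triple cover of `A` in `M'`. Three of the connecting spheres are incident to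
it, one for each copy of `B'`. Two of them can be cut without disconnecting `M'`: the third still
attaches the piece `b₀`, and as `n ≥ 2` there is another piece `b₁`, to which all three copies of
`B'` remain attached (`isConnected_compl_spheres`). In particular each of them is nonseparating.
Parallel copies of the two spheres are the levels `1/2` of two circle maps on `M'` (`sphereClass`).
Each level is crossed once by a path disjoint from the other (`hasTransversals_sphereClass`) and the
two do not jointly separate, so the two classes in `H¹(M'; ℝ)` are linearly independent and
`b₁(M') ≥ 2` (`two_le_bettiOne_of_circleMaps`).

Homology enters only through functions on paths that are additive on triangles (`IsPathCocycle`),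
which are compared with singular homology in degree one by `exists_isPathCocycle_of_one_le_bettiOne`
and `two_le_bettiOne`. The smooth structure of `M'` is pulled back from `M`, and a lift of a sphere
parallel to the connect sum sphere is smoothly embedded by `isEmbeddedSphere_of_lift`.
-/

/-! ### Singular cohomology classes as functions on paths -/

section PathCocycles

open unitInterval

/-- The straight path from `p` to `q` in the square. -/
def squareSegment (p q : I × I) : C(I, I × I) where
  toFun t :=
    (⟨(1 - t) * p.1 + t * q.1, by
      have := t.2; have := p.1.2; have := q.1.2
      simp only [Set.mem_Icc] at *
      constructor <;> nlinarith⟩,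
     ⟨(1 - t) * p.2 + t * q.2, by
      have := t.2; have := p.2.2; have := q.2.2
      simp only [Set.mem_Icc] at *
      constructor <;> nlinarith⟩)
  continuous_toFun := by fun_prop

/-- A `G`-valued function on paths is a cocycle if it is additive on the edges of every triangle
that is the image of an affine triangle of the square. These are the singular `1`-cocycles, after
the identification of the standard `1`-simplex with the unit interval. -/
def IsPathCocycle {X G : Type*} [TopologicalSpace X] [Add G] (c : C(I, X) → G) : Prop :=
  ∀ (F : C(I × I, X)) (p q r : I × I),
    c (F.comp (squareSegment p q)) + c (F.comp (squareSegment q r)) = c (F.comp (squareSegment p r))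

end PathCocycles

section Singular

open CategoryTheory AlgebraicTopology Simplicial

variable (X : Type u) [TopologicalSpace X]

/-- The singular simplicial set of `X`. -/
noncomputable abbrev singularSet : SSet.{u} := TopCat.toSSet.obj (TopCat.of X)

/-- The singular chain complex of `X` with integer coefficients. -/
noncomputable abbrev singularChains : ChainComplex (ModuleCat.{u} ℤ) ℕ :=
  (singularSet X).chainComplex (ModuleCat.of ℤ (ULift.{u} ℤ))

variable {X}

/-- Singular `1`-simplices are paths. -/
noncomputable def simplexPath : singularSet X _⦋1⦌ ≃ C(unitInterval, X) :=
  ((TopCat.of X).toSSetObjEquiv _).trans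
    (stdSimplexHomeomorphUnitInterval.continuousMapCongr (.refl _))

lemma simplexPath_apply (σ : singularSet X _⦋1⦌) (t : unitInterval) :
    simplexPath σ t =
      (TopCat.of X).toSSetObjEquiv _ σ (stdSimplexHomeomorphUnitInterval.symm t) := rfl

lemma stdSimplex_map_val {m n : ℕ} (f : Fin m → Fin n) (s : stdSimplex ℝ (Fin m)) (j : Fin n) :
    (stdSimplex.map f s).1 j = ∑ i, if f i = j then s.1 i else 0 := by
  change FunOnFinite.linearMap ℝ ℝ f s j = _
  rw [FunOnFinite.linearMap_apply_apply, Finset.sum_filter]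
  rfl

/-- The face `0` of a `1`-simplex is its endpoint at time `1`. -/
lemma toSSetObj₀Equiv_δ_zero (σ : singularSet X _⦋1⦌) :
    TopCat.toSSetObj₀Equiv ((singularSet X).δ 0 σ) = simplexPath σ 1 := by
  rw [simplexPath_apply, TopCat.toSSetObj₀Equiv_apply]
  erw [TopCat.toSSetObjEquiv_δ_apply]
  congr 1
  apply Subtype.ext
  funext i
  rw [stdSimplex_map_val, Fin.sum_univ_one]
  have h1 : (default : stdSimplex ℝ (Fin 1)).1 0 = 1 := stdSimplex.eq_one_of_unique _ _
  fin_cases i <;> simp [h1, stdSimplexHomeomorphUnitInterval, stdSimplexEquivIcc]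

lemma toSSetObj₀Equiv_δ_one (σ : singularSet X _⦋1⦌) :
    TopCat.toSSetObj₀Equiv ((singularSet X).δ 1 σ) = simplexPath σ 0 := by
  rw [simplexPath_apply, TopCat.toSSetObj₀Equiv_apply]
  erw [TopCat.toSSetObjEquiv_δ_apply]
  congr 1
  apply Subtype.ext
  funext i
  rw [stdSimplex_map_val, Fin.sum_univ_one]
  have h1 : (default : stdSimplex ℝ (Fin 1)).1 0 = 1 := stdSimplex.eq_one_of_unique _ _
  fin_cases i <;> simp [h1, stdSimplexHomeomorphUnitInterval, stdSimplexEquivIcc]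

lemma convexComb_mem_unitInterval (x : stdSimplex ℝ (Fin 3)) (a b c : unitInterval) :
    x.1 0 * a + x.1 1 * b + x.1 2 * c ∈ unitInterval := by
  have hs : x.1 0 + x.1 1 + x.1 2 = 1 := by have := x.2.2; rwa [Fin.sum_univ_three] at this
  have h0 := x.2.1 0
  have h1 := x.2.1 1
  have h2 := x.2.1 2
  constructor
  · have := mul_nonneg h0 a.2.1; have := mul_nonneg h1 b.2.1
    have := mul_nonneg h2 c.2.1; linarith
  · linarith [mul_le_of_le_one_right h0 a.2.2, mul_le_of_le_one_right h1 b.2.2,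
      mul_le_of_le_one_right h2 c.2.2]

/-- The affine parametrization of a triangle in the square. -/
def squareTriangle (p q r : unitInterval × unitInterval) :
    C(stdSimplex ℝ (Fin 3), unitInterval × unitInterval) where
  toFun x :=
    (⟨x.1 0 * p.1 + x.1 1 * q.1 + x.1 2 * r.1, convexComb_mem_unitInterval x p.1 q.1 r.1⟩,
     ⟨x.1 0 * p.2 + x.1 1 * q.2 + x.1 2 * r.2, convexComb_mem_unitInterval x p.2 q.2 r.2⟩)
  continuous_toFun := by
    have hc (a b c : unitInterval) : Continuous fun x : stdSimplex ℝ (Fin 3) ↦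
        x.1 0 * (a : ℝ) + x.1 1 * b + x.1 2 * c := by
      have (i : Fin 3) : Continuous fun x : stdSimplex ℝ (Fin 3) ↦ x.1 i :=
        (continuous_apply i).comp continuous_subtype_val
      exact (((this 0).mul continuous_const).add ((this 1).mul continuous_const)).add
        ((this 2).mul continuous_const)
    exact .prodMk (.subtype_mk (hc _ _ _) _) (.subtype_mk (hc _ _ _) _)

/-- A retraction of the square onto the triangle below the diagonal, identified with the standard
`2`-simplex. -/
noncomputable def squareRetraction :
    C(unitInterval × unitInterval, stdSimplex ℝ (Fin 3)) where
  toFun p := ⟨![1 - p.1, p.1 - min (p.1 : ℝ) p.2, min (p.1 : ℝ) p.2], by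
    constructor
    · intro i
      have := p.1.2.1; have := p.1.2.2; have := p.2.2.1
      fin_cases i <;> simp <;> first | assumption | constructor <;> assumption
    · simp [Fin.sum_univ_three]⟩
  continuous_toFun := by
    refine Continuous.subtype_mk (continuous_pi fun i ↦ ?_) _
    fin_cases i
    · change Continuous fun p : unitInterval × unitInterval ↦ 1 - (p.1 : ℝ)
      fun_prop
    · change Continuous fun p : unitInterval × unitInterval ↦ (p.1 : ℝ) - min (p.1 : ℝ) p.2
      fun_prop
    · change Continuous fun p : unitInterval × unitInterval ↦ min (p.1 : ℝ) p.2
      fun_prop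

/-- The singular `2`-simplex of an affine triangle in a singular square. -/
noncomputable def triangleSimplex (F : C(unitInterval × unitInterval, X))
    (p q r : unitInterval × unitInterval) : singularSet X _⦋2⦌ :=
  ((TopCat.of X).toSSetObjEquiv _).symm (F.comp (squareTriangle p q r))

lemma simplexPath_δ_apply (τ : singularSet X _⦋2⦌) (i : Fin 3) (t : unitInterval) :
    simplexPath ((singularSet X).δ i τ) t =
      (TopCat.of X).toSSetObjEquiv _ τ
        (stdSimplex.map i.succAbove (stdSimplexHomeomorphUnitInterval.symm t)) := by
  rw [simplexPath_apply]
  erw [TopCat.toSSetObjEquiv_δ_apply]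

/-- The three faces of the standard `2`-simplex, in barycentric coordinates. -/
lemma stdSimplex_face_val (t : unitInterval) :
    (stdSimplex.map (Fin.succAbove 0) (stdSimplexHomeomorphUnitInterval.symm t)).1 =
      ![0, 1 - (t : ℝ), t] ∧
    (stdSimplex.map (Fin.succAbove 1) (stdSimplexHomeomorphUnitInterval.symm t)).1 =
      ![1 - (t : ℝ), 0, t] ∧
    (stdSimplex.map (Fin.succAbove 2) (stdSimplexHomeomorphUnitInterval.symm t)).1 =
      ![1 - (t : ℝ), t, 0] := by
  have e0 : (stdSimplexHomeomorphUnitInterval.symm t).1 0 = 1 - (t : ℝ) := rfl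
  have e1 : (stdSimplexHomeomorphUnitInterval.symm t).1 1 = t := rfl
  refine ⟨?_, ?_, ?_⟩ <;>
  · funext j
    rw [stdSimplex_map_val, Fin.sum_univ_two, e0, e1]
    fin_cases j <;> simp [Fin.succAbove]

/-- The faces of the `2`-simplex of an affine triangle are the edges of the triangle. -/
lemma simplexPath_δ_triangleSimplex (F : C(unitInterval × unitInterval, X))
    (p q r : unitInterval × unitInterval) :
    simplexPath ((singularSet X).δ 0 (triangleSimplex F p q r)) = F.comp (squareSegment q r) ∧
    simplexPath ((singularSet X).δ 1 (triangleSimplex F p q r)) = F.comp (squareSegment p r) ∧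
    simplexPath ((singularSet X).δ 2 (triangleSimplex F p q r)) = F.comp (squareSegment p q) := by
  refine ⟨?_, ?_, ?_⟩ <;>
  · ext t
    rw [simplexPath_δ_apply, triangleSimplex, Equiv.apply_symm_apply]
    simp only [ContinuousMap.comp_apply]
    obtain ⟨h0, h1, h2⟩ := stdSimplex_face_val t
    congr 1
    ext <;> simp only [squareTriangle, squareSegment, ContinuousMap.coe_mk, h0, h1, h2] <;> simp

/-- Every singular `2`-simplex is the restriction of a singular square to an affine triangle, so
that the condition in `IsPathCocycle` sees all of them. -/
lemma simplexPath_δ (τ : singularSet X _⦋2⦌) :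
    ∃ (F : C(unitInterval × unitInterval, X)) (p q r : unitInterval × unitInterval),
    simplexPath ((singularSet X).δ 0 τ) = F.comp (squareSegment q r) ∧
    simplexPath ((singularSet X).δ 1 τ) = F.comp (squareSegment p r) ∧
    simplexPath ((singularSet X).δ 2 τ) = F.comp (squareSegment p q) := by
  refine ⟨((TopCat.of X).toSSetObjEquiv _ τ).comp squareRetraction, (0, 0), (1, 0), (1, 1), ?_⟩
  refine ⟨?_, ?_, ?_⟩ <;>
  · ext t
    rw [simplexPath_δ_apply]
    simp only [ContinuousMap.comp_apply]
    congr 1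
    apply Subtype.ext
    obtain ⟨h0, h1, h2⟩ := stdSimplex_face_val t
    first | rw [h0] | rw [h1] | rw [h2]
    have ht0 := t.2.1
    have ht1 := t.2.2
    funext i
    fin_cases i <;> simp [squareRetraction, squareSegment, ht0, ht1]

/-- The homomorphism from the integers that sends `1` to `a`. -/
noncomputable def fromIntegers {A : Type u} [AddCommGroup A] (a : A) :
    ModuleCat.of ℤ (ULift.{u} ℤ) ⟶ ModuleCat.of ℤ A :=
  ModuleCat.ofHom ((LinearMap.toSpanSingleton ℤ A a).comp ULift.moduleEquiv.toLinearMap)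

lemma integers_hom_ext {A : ModuleCat.{u} ℤ} {f g : ModuleCat.of ℤ (ULift.{u} ℤ) ⟶ A}
    (h : f.hom ⟨1⟩ = g.hom ⟨1⟩) : f = g := by
  ext k
  have : k = k.down • (⟨1⟩ : ULift.{u} ℤ) := by ext; simp
  rw [this, LinearMap.map_smul, LinearMap.map_smul, h]

lemma fromIntegers_one {A : Type u} [AddCommGroup A] (a : A) : (fromIntegers a).hom ⟨1⟩ = a :=
  one_smul ℤ a

lemma fromIntegers_add {A : Type u} [AddCommGroup A] (a b : A) :
    fromIntegers (a + b) = fromIntegers a + fromIntegers b := by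
  apply integers_hom_ext
  rw [fromIntegers_one]
  exact congrArg₂ (· + ·) (fromIntegers_one a).symm (fromIntegers_one b).symm

lemma fromIntegers_sub {A : Type u} [AddCommGroup A] (a b : A) :
    fromIntegers (a - b) = fromIntegers a - fromIntegers b := by
  rw [eq_sub_iff_add_eq, ← fromIntegers_add, sub_add_cancel]

/-- The homomorphism on singular chains given by a function on singular simplices. -/
noncomputable def cochainHom {A : Type u} [AddCommGroup A] {n : ℕ} (c : singularSet X _⦋n⦌ → A) :
    (singularChains X).X n ⟶ ModuleCat.of ℤ A :=
  ((singularSet X).isColimitChainComplexXCofan _ n).desc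
    (Limits.Cofan.mk _ fun s ↦ fromIntegers (c s))

@[simp]
lemma ι_cochainHom {A : Type u} [AddCommGroup A] {n : ℕ} (c : singularSet X _⦋n⦌ → A)
    (s : singularSet X _⦋n⦌) :
    (singularSet X).ιChainComplex s ≫ cochainHom c = fromIntegers (c s) :=
  ((singularSet X).isColimitChainComplexXCofan _ n).fac _ ⟨s⟩

/-- The coboundary of a function on points is the difference of its values at the ends of paths. -/
lemma d_cochainHom_zero {A : Type u} [AddCommGroup A] (h : X → A) :
    (singularChains X).d 1 0 ≫ cochainHom (fun s ↦ h (TopCat.toSSetObj₀Equiv s)) =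
      cochainHom (fun s ↦ h (simplexPath s 1) - h (simplexPath s 0)) := by
  refine SSet.chainComplex_hom_ext fun s ↦ ?_
  rw [SSet.ιChainComplex_d_assoc, ι_cochainHom]
  rw [fromIntegers_sub, ← toSSetObj₀Equiv_δ_zero, ← toSSetObj₀Equiv_δ_one]
  simp [Fin.sum_univ_two, Preadditive.add_comp, sub_eq_add_neg]

lemma d_cochainHom_one {A : Type u} [AddCommGroup A] (c : C(unitInterval, X) → A)
    (hc : IsPathCocycle c) :
    (singularChains X).d 2 1 ≫ cochainHom (fun s ↦ c (simplexPath s)) = 0 := by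
  refine SSet.chainComplex_hom_ext fun s ↦ ?_
  rw [SSet.ιChainComplex_d_assoc]
  obtain ⟨F, p, q, r, h0, h1, h2⟩ := simplexPath_δ s
  simp [Fin.sum_univ_three, Preadditive.add_comp, h0, h1, h2, ← hc F p q r, fromIntegers_add]

/-- A nonzero rank is detected by a rational functional, also after an injection. -/
lemma exists_rat_functional_of_rank_ne_zero {V W : Type*} [AddCommGroup V] [Module ℤ V]
    [AddCommGroup W] [Module ℤ W] (h : Module.rank ℤ V ≠ 0) (f : V →ₗ[ℤ] W)
    (hf : Function.Injective f) : ∃ (w : V) (l : W →ₗ[ℤ] ℚ), l (f w) = 1 := by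
  rw [Ne, rank_eq_zero_iff] at h
  push Not at h
  obtain ⟨w, hw⟩ := h
  have hv : Function.Injective (LinearMap.toSpanSingleton ℤ W (f w)) := by
    rw [← LinearMap.ker_eq_bot, LinearMap.ker_eq_bot']
    intro a ha
    by_contra h0
    refine hw a h0 (hf ?_)
    rw [LinearMap.map_smul, map_zero]
    simpa using ha
  obtain ⟨l, hl⟩ := (Module.Baer.of_divisible ℚ).extension_property _ hv
    (LinearMap.toSpanSingleton ℤ ℚ 1)
  refine ⟨w, l, ?_⟩
  simpa using congr($hl 1)

/-- If two real functionals are linearly independent over `ℝ`, the rank is at least `2`. -/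
lemma two_le_rank_of_functionals {V : Type*} [AddCommGroup V] [Module ℤ V] (f g : V →ₗ[ℤ] ℝ)
    (h : ∀ α β : ℝ, (∀ v, α * f v + β * g v = 0) → α = 0 ∧ β = 0) :
    2 ≤ Module.rank ℤ V := by
  obtain ⟨v, hv⟩ : ∃ v, f v ≠ 0 := by
    by_contra! H
    exact one_ne_zero (h 1 0 fun v ↦ by simp [H v]).1
  obtain ⟨w, hw⟩ : ∃ w, g v * f w - f v * g w ≠ 0 := by
    by_contra! H
    exact hv (neg_eq_zero.1 (h (g v) (-f v) fun w ↦ by linarith [H w]).2)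
  have hli : LinearIndependent ℤ ![v, w] := by
    rw [LinearIndependent.pair_iff]
    intro a b hab
    have hf := congrArg f hab
    have hg := congrArg g hab
    simp only [map_add, LinearMap.map_smul, map_zero, zsmul_eq_mul] at hf hg
    have hb : (b : ℝ) = 0 := by
      have : (b : ℝ) * (g v * f w - f v * g w) = 0 := by linear_combination g v * hf - f v * hg
      exact (mul_eq_zero.1 this).resolve_right hw
    rw [hb, zero_mul, add_zero] at hf
    exact ⟨by exact_mod_cast (mul_eq_zero.1 hf).resolve_right hv, by exact_mod_cast hb⟩
  simpa using hli.cardinal_lift_le_rank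

/-- If the first Betti number of `X` is positive, there is a rational cocycle on `X` that is not
a coboundary. -/
theorem exists_isPathCocycle_of_one_le_bettiOne (h : 1 ≤ bettiOne X) :
    ∃ c : C(unitInterval, X) → ℚ, IsPathCocycle c ∧
      ¬ ∃ g : X → ℚ, ∀ γ, c γ = g (γ 1) - g (γ 0) := by
  -- a functional on the opcycles that is nonzero on homology is a cocycle with a nonzero class
  obtain ⟨w, l, hl⟩ := exists_rat_functional_of_rank_ne_zero
    (V := (singularChains X).homology 1) (W := (singularChains X).opcycles 1)
    (zero_lt_one.trans_le h).ne' ((singularChains X).homologyι 1).hom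
    ((ModuleCat.mono_iff_injective _).1 inferInstance)
  let L : (singularChains X).opcycles 1 ⟶ ModuleCat.of ℤ (ULift.{u} ℚ) :=
    ModuleCat.ofHom (ULift.moduleEquiv.symm.toLinearMap.comp l)
  let c (s : singularSet X _⦋1⦌) : ULift.{u} ℚ :=
    ((singularSet X).ιChainComplex s ≫ (singularChains X).pOpcycles 1 ≫ L).hom ⟨1⟩
  refine ⟨fun γ ↦ (c (simplexPath.symm γ)).down, ?_, ?_⟩
  · intro F p q r
    obtain ⟨h0, h1, h2⟩ := simplexPath_δ_triangleSimplex F p q r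
    simp only [← h0, ← h1, ← h2, Equiv.symm_apply_apply]
    have key : (singularSet X).ιChainComplex (triangleSimplex F p q r) ≫
        (singularChains X).d 2 1 ≫ (singularChains X).pOpcycles 1 ≫ L = 0 := by simp
    rw [SSet.ιChainComplex_d_assoc] at key
    have k2 : c ((singularSet X).δ 0 (triangleSimplex F p q r)) -
      c ((singularSet X).δ 1 (triangleSimplex F p q r)) +
      c ((singularSet X).δ 2 (triangleSimplex F p q r)) = 0 := by
      have key' := congr(($key).hom ⟨1⟩)
      simpa [c, sub_eq_add_neg, Fin.sum_univ_three, Preadditive.add_comp] using key'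
    have k3 := congrArg ULift.down k2
    simp only [ULift.add_down, ULift.sub_down, ULift.zero_down] at k3
    linarith
  · rintro ⟨g, hg⟩
    have key : (singularChains X).pOpcycles 1 ≫ L = (singularChains X).d 1 0 ≫
        cochainHom (fun s ↦ (⟨g (TopCat.toSSetObj₀Equiv s)⟩ : ULift.{u} ℚ)) := by
      rw [d_cochainHom_zero (A := ULift.{u} ℚ) (fun x ↦ ⟨g x⟩)]
      refine SSet.chainComplex_hom_ext fun s ↦ ?_
      rw [ι_cochainHom]
      apply integers_hom_ext
      have := hg (simplexPath s)
      simp only [Equiv.symm_apply_apply] at this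
      rw [fromIntegers_one]
      exact ULift.ext _ _ this
    obtain ⟨z, hz⟩ := (ModuleCat.epi_iff_surjective ((singularChains X).homologyπ 1)).1
      inferInstance w
    have h1 : (singularChains X).homologyπ 1 ≫ (singularChains X).homologyι 1 ≫ L = 0 := by
      rw [HomologicalComplex.homology_π_ι_assoc, key]
      simp
    have h2 : L.hom (((singularChains X).homologyι 1).hom
      (((singularChains X).homologyπ 1).hom z)) = 0 := congr(($h1).hom z)
    erw [hz] at h2
    have h3 : l (((singularChains X).homologyι 1).hom w) = 0 := congrArg ULift.down h2
    exact one_ne_zero (hl.symm.trans h3)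

/-- Two real cocycles whose classes are linearly independent force the first Betti number to be
at least `2`. -/
theorem two_le_bettiOne [PathConnectedSpace X] (c₁ c₂ : C(unitInterval, X) → ℝ)
    (h₁ : IsPathCocycle c₁) (h₂ : IsPathCocycle c₂)
    (h : ∀ α β : ℝ, (∃ g : X → ℝ, ∀ γ, α * c₁ γ + β * c₂ γ = g (γ 1) - g (γ 0)) →
      α = 0 ∧ β = 0) : 2 ≤ bettiOne X := by
  let φ (c : C(unitInterval, X) → ℝ) : (singularChains X).X 1 ⟶ ModuleCat.of ℤ (ULift.{u} ℝ) :=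
    cochainHom fun s ↦ ⟨c (simplexPath s)⟩
  have hφ (c) (hc : IsPathCocycle c) : (singularChains X).d 2 1 ≫ φ c = 0 :=
    d_cochainHom_one (A := ULift.{u} ℝ) (fun γ ↦ ⟨c γ⟩) fun F p q r ↦ ULift.ext _ _ (hc F p q r)
  -- evaluation of a cocycle on homology classes
  let Φ (c : C(unitInterval, X) → ℝ) (hc : IsPathCocycle c) :
      (singularChains X).homology 1 ⟶ ModuleCat.of ℤ (ULift.{u} ℝ) :=
    (singularChains X).homologyι 1 ≫ (singularChains X).descOpcycles (φ c) 2 (by simp) (hφ c hc)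
  let Ψ (c : C(unitInterval, X) → ℝ) (hc : IsPathCocycle c) :
      (singularChains X).homology 1 →ₗ[ℤ] ℝ :=
    ULift.moduleEquiv.toLinearMap.comp (Φ c hc).hom
  refine two_le_rank_of_functionals (V := (singularChains X).homology 1) (Ψ c₁ h₁) (Ψ c₂ h₂)
    fun α β hαβ ↦ h α β ?_
  obtain ⟨x₀⟩ : Nonempty X := inferInstance
  let γ (x : X) : C(unitInterval, X) := (PathConnectedSpace.somePath x₀ x : Path x₀ x)
  refine ⟨fun x ↦ α * c₁ (γ x) + β * c₂ (γ x), fun τ ↦ ?_⟩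
  -- the closed polygon formed by the path and the chosen paths to its two ends
  let ζ : ModuleCat.of ℤ (ULift.{u} ℤ) ⟶ (singularChains X).X 1 :=
    (singularSet X).ιChainComplex (simplexPath.symm τ) +
      (singularSet X).ιChainComplex (simplexPath.symm (γ (τ 0))) -
      (singularSet X).ιChainComplex (simplexPath.symm (γ (τ 1)))
  have hζ : ζ ≫ (singularChains X).d 1 0 = 0 := by
    have hδ (ρ : C(unitInterval, X)) :
        (singularSet X).ιChainComplex (simplexPath.symm ρ) ≫ (singularChains X).d 1 0 =
        (singularSet X).ιChainComplex (TopCat.toSSetObj₀Equiv.symm (ρ 1)) -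
        (singularSet X).ιChainComplex (TopCat.toSSetObj₀Equiv.symm (ρ 0)) := by
      rw [SSet.ιChainComplex_d]
      have e0 := toSSetObj₀Equiv_δ_zero (simplexPath.symm ρ)
      have e1 := toSSetObj₀Equiv_δ_one (simplexPath.symm ρ)
      rw [← Equiv.eq_symm_apply, Equiv.apply_symm_apply] at e0 e1
      simp [Fin.sum_univ_two, e0, e1, sub_eq_add_neg]
    have hγ0 (x : X) : γ x 0 = x₀ := (PathConnectedSpace.somePath x₀ x).source
    have hγ1 (x : X) : γ x 1 = x := (PathConnectedSpace.somePath x₀ x).target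
    simp only [ζ, Preadditive.add_comp, Preadditive.sub_comp, hδ, hγ0, hγ1]
    abel
  have hval (c) (hc : IsPathCocycle c) :
      Ψ c hc (((singularChains X).liftCycles ζ 0 (by simp) hζ ≫
        (singularChains X).homologyπ 1).hom ⟨1⟩) = c τ + c (γ (τ 0)) - c (γ (τ 1)) := by
    have : ((singularChains X).liftCycles ζ 0 (by simp) hζ ≫
        (singularChains X).homologyπ 1) ≫ Φ c hc = ζ ≫ φ c := by
      simp only [Φ, Category.assoc, HomologicalComplex.homology_π_ι_assoc,
        HomologicalComplex.p_descOpcycles, HomologicalComplex.liftCycles_i_assoc]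
    have hζφ : ζ ≫ φ c = fromIntegers ⟨c τ + c (γ (τ 0)) - c (γ (τ 1))⟩ := by
      rw [show (⟨c τ + c (γ (τ 0)) - c (γ (τ 1))⟩ : ULift.{u} ℝ) =
        ⟨c τ⟩ + ⟨c (γ (τ 0))⟩ - ⟨c (γ (τ 1))⟩ from rfl, fromIntegers_sub, fromIntegers_add]
      simp [ζ, φ, Preadditive.add_comp, Preadditive.sub_comp]
    rw [hζφ] at this
    have h2 : ((Φ c hc).hom (((singularChains X).liftCycles ζ 0 (by simp) hζ ≫
        (singularChains X).homologyπ 1).hom ⟨1⟩)).down = _ := congr((($this).hom ⟨1⟩).down)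
    rw [fromIntegers_one] at h2
    exact h2
  have := hαβ (((singularChains X).liftCycles ζ 0 (by simp) hζ ≫
        (singularChains X).homologyπ 1).hom ⟨1⟩)
  rw [hval _ h₁, hval _ h₂] at this
  linarith

end Singular

/-! ### Maps to the circle and their cocycles -/

section CircleMaps

open unitInterval Topology

variable {X : Type*} [TopologicalSpace X]

lemma IsPathCocycle.const_eq_zero {G : Type*} [AddCommGroup G] {c : C(I, X) → G}
    (hc : IsPathCocycle c) (x : X) : c (ContinuousMap.const _ x) = 0 := by
  have := hc (ContinuousMap.const _ x) 0 0 0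
  simpa [ContinuousMap.const_comp] using this

lemma squareSegment_apply_zero (p q : I × I) : squareSegment p q 0 = p := by
  ext <;> simp [squareSegment]

lemma squareSegment_apply_one (p q : I × I) : squareSegment p q 1 = q := by
  ext <;> simp [squareSegment]

/-- A map to the circle from a simply connected, locally path connected space has a real lift. -/
lemma exists_real_lift {Y : Type*} [TopologicalSpace Y] [SimplyConnectedSpace Y]
    [LocallyPathConnectedSpace Y] (f : C(Y, UnitAddCircle)) :
    ∃ F : C(Y, ℝ), ∀ y, (F y : UnitAddCircle) = f y := by
  obtain ⟨y₀⟩ : Nonempty Y := inferInstance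
  obtain ⟨r, hr⟩ := QuotientAddGroup.mk_surjective (f y₀)
  obtain ⟨F, ⟨-, hF⟩, -⟩ :=
    (AddCircle.isCoveringMap_coe (1 : ℝ)).existsUnique_continuousMap_lifts f y₀ r hr
  exact ⟨F, congrFun hF⟩

instance : ContractibleSpace I := (convex_Icc (0 : ℝ) 1).contractibleSpace ⟨0, by simp⟩

instance : LocallyPathConnectedSpace I := (convex_Icc (0 : ℝ) 1).locallyPathConnectedSpace

lemma unitAddCircle_coe_eq_coe {a b : ℝ} :
    (a : UnitAddCircle) = b ↔ ∃ n : ℤ, a - b = n := by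
  rw [← sub_eq_zero, ← AddCircle.coe_sub, AddCircle.coe_eq_zero_iff]
  simp [eq_comm]

/-- Real functions on a connected space that agree modulo `1` differ by a constant. -/
lemma sub_eq_sub_of_coe_eq {Y : Type*} [TopologicalSpace Y] [PreconnectedSpace Y] {F G : Y → ℝ}
    (hF : Continuous F) (hG : Continuous G) (h : ∀ y, (F y : UnitAddCircle) = G y) (y z : Y) :
    F y - F z = G y - G z := by
  have h1 : (fun x ↦ F x) = fun x ↦ G x + (F z - G z) := by
    refine (AddCircle.isCoveringMap_coe (1 : ℝ)).eq_of_comp_eq hF (by fun_prop) ?_ z (by ring)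
    funext x
    simp only [Function.comp_apply]
    rw [AddCircle.coe_add, AddCircle.coe_sub, h, h]
    simp
  have := congrFun h1 y
  linarith

/-- The real cocycle of a map `u` to the circle: its value on a path is the total change of a
real lift of `u` along the path. -/
noncomputable def circleCochain (u : C(X, UnitAddCircle)) (γ : C(I, X)) : ℝ :=
  (exists_real_lift (u.comp γ)).choose 1 - (exists_real_lift (u.comp γ)).choose 0

lemma circleCochain_eq (u : C(X, UnitAddCircle)) (γ : C(I, X)) {F : I → ℝ} (hF : Continuous F)
    (h : ∀ t, (F t : UnitAddCircle) = u (γ t)) : circleCochain u γ = F 1 - F 0 :=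
  sub_eq_sub_of_coe_eq (ContinuousMap.continuous _) hF
    (fun t ↦ ((exists_real_lift (u.comp γ)).choose_spec t).trans (h t).symm) 1 0

lemma isPathCocycle_circleCochain (u : C(X, UnitAddCircle)) : IsPathCocycle (circleCochain u) := by
  intro F p q r
  obtain ⟨G, hG⟩ := exists_real_lift (u.comp F)
  have h (p q : I × I) : circleCochain u (F.comp (squareSegment p q)) = G q - G p := by
    rw [circleCochain_eq u _ (F := fun t ↦ G (squareSegment p q t)) (by fun_prop)
      (fun t ↦ hG _), squareSegment_apply_one, squareSegment_apply_zero]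
  rw [h, h, h]
  ring

lemma coe_circleCochain (u : C(X, UnitAddCircle)) (γ : C(I, X)) :
    (circleCochain u γ : UnitAddCircle) = u (γ 1) - u (γ 0) := by
  rw [circleCochain, AddCircle.coe_sub, (exists_real_lift (u.comp γ)).choose_spec,
    (exists_real_lift (u.comp γ)).choose_spec]
  rfl

lemma circleCochain_nsmul (n : ℕ) (u v : C(X, UnitAddCircle)) (h : ∀ x, u x = n • v x)
    (γ : C(I, X)) : circleCochain u γ = n * circleCochain v γ := by
  obtain ⟨F, hF⟩ := exists_real_lift (v.comp γ)
  rw [circleCochain_eq v γ F.continuous hF,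
    circleCochain_eq u γ (F := fun t ↦ n * F t) (by fun_prop) fun t ↦ ?_]
  · ring
  · rw [h, ← nsmul_eq_mul, AddCircle.coe_nsmul, hF]
    rfl

/-- A cocycle is additive under subdivision, so it vanishes if it vanishes on all paths that are
small of order an open cover. -/
lemma IsPathCocycle.eq_zero_of_small {G ι : Type*} [AddCommGroup G] {c : C(I, X) → G}
    (hc : IsPathCocycle c) (U : ι → Set X) (hU : ∀ i, IsOpen (U i)) (hcov : ⋃ i, U i = Set.univ)
    (h : ∀ i, ∀ γ : C(I, X), (∀ t, γ t ∈ U i) → c γ = 0) (γ : C(I, X)) : c γ = 0 := by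
  obtain ⟨t, t0, tmono, ⟨n, hn⟩, ht⟩ := exists_monotone_Icc_subset_open_cover_unitInterval
    (c := fun i ↦ γ ⁻¹' U i) (fun i ↦ (hU i).preimage γ.continuous)
    (by rw [← Set.preimage_iUnion, hcov]; simp)
  -- the degenerate square in which the subpaths of `γ` are edges of triangles
  let F : C(I × I, X) := γ.comp ⟨Prod.fst, continuous_fst⟩
  have key (k : ℕ) : c (F.comp (squareSegment (0, 0) (t k, 0))) = 0 := by
    induction k with
    | zero =>
      rw [t0]
      convert hc.const_eq_zero (γ 0) using 2
      ext s
      simp [F, squareSegment]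
    | succ k ih =>
      rw [← hc F (0, 0) (t k, 0) (t (k + 1), 0), ih, zero_add]
      obtain ⟨i, hi⟩ := ht k
      refine h i _ fun s ↦ hi ?_
      have h1 : (t k : ℝ) ≤ t (k + 1) := tmono (Nat.le_succ k)
      have hs := s.2.1
      have hs' := s.2.2
      constructor
      · change (t k : ℝ) ≤ (1 - s) * t k + s * t (k + 1)
        nlinarith
      · change (1 - s) * t k + s * t (k + 1) ≤ (t (k + 1) : ℝ)
        nlinarith
  have := key n
  rw [hn n le_rfl] at this
  convert this using 2
  ext s
  simp [F, squareSegment]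

/-- On a set that contracts in the ambient space, a cocycle is a coboundary. -/
lemma IsPathCocycle.exists_primitive_of_contraction {G : Type*} [AddCommGroup G] {c : C(I, X) → G}
    (hc : IsPathCocycle c) (U : Set X) (a : X) (K : C(I × U, X)) (h0 : ∀ x, K (0, x) = a)
    (h1 : ∀ x : U, K (1, x) = x) :
    ∃ g : X → G, ∀ γ : C(I, X), (∀ t, γ t ∈ U) → c γ = g (γ 1) - g (γ 0) := by
  classical
  refine ⟨fun x ↦ if hx : x ∈ U then c (K.comp ⟨fun s ↦ (s, ⟨x, hx⟩), by fun_prop⟩) else 0,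
    fun γ hγ ↦ ?_⟩
  let γ' : C(I, U) := ⟨fun t ↦ ⟨γ t, hγ t⟩, by fun_prop⟩
  let F : C(I × I, X) := K.comp ((ContinuousMap.id I).prodMap γ')
  beta_reduce
  rw [dif_pos (hγ 1), dif_pos (hγ 0)]
  -- the square `F` has the edges `a` (constant), `γ`, and the two tracks of the contraction
  have e1 := hc F (0, 0) (1, 0) (1, 1)
  have e2 := hc F (0, 0) (0, 1) (1, 1)
  have f1 : F.comp (squareSegment (0, 0) (1, 0)) =
      K.comp ⟨fun s ↦ (s, ⟨γ 0, hγ 0⟩), by fun_prop⟩ := by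
    ext s; simp [F, squareSegment, γ']
  have f2 : F.comp (squareSegment (1, 0) (1, 1)) = γ := by
    ext s; simp [F, squareSegment, γ', h1]
  have f3 : F.comp (squareSegment (0, 0) (0, 1)) = ContinuousMap.const _ a := by
    ext s; simp [F, squareSegment, γ', h0]
  have f4 : F.comp (squareSegment (0, 1) (1, 1)) =
      K.comp ⟨fun s ↦ (s, ⟨γ 1, hγ 1⟩), by fun_prop⟩ := by
    ext s; simp [F, squareSegment, γ']
  rw [f1, f2] at e1
  rw [f3, f4, hc.const_eq_zero, zero_add] at e2
  rw [e2, ← e1]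
  abel

/-- Points of a manifold with boundary have open neighbourhoods on which every cocycle is a
coboundary: the preimages of half balls in a chart. -/
lemma IsPathCocycle.exists_local_primitive {A G : Type*} [TopologicalSpace A]
    [ChartedSpace (EuclideanHalfSpace 3) A] [AddCommGroup G] {c : C(I, A) → G}
    (hc : IsPathCocycle c) (a : A) : ∃ U : Set A, IsOpen U ∧ a ∈ U ∧
      ∃ g : A → G, ∀ γ : C(I, A), (∀ t, γ t ∈ U) → c γ = g (γ 1) - g (γ 0) := by
  set e := chartAt (EuclideanHalfSpace 3) a
  obtain ⟨O, hO, hOt⟩ := isOpen_induced_iff.1 e.open_target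
  have haO : (e a).1 ∈ O := by
    change e a ∈ Subtype.val ⁻¹' O
    rw [hOt]
    exact e.map_source (mem_chart_source _ a)
  obtain ⟨r, hr, hrO⟩ := Metric.isOpen_iff.1 hO _ haO
  let U : Set A := e.source ∩ e ⁻¹' (Subtype.val ⁻¹' Metric.ball (e a).1 r)
  have hUo : IsOpen U :=
    e.isOpen_inter_preimage (Metric.isOpen_ball.preimage continuous_subtype_val)
  refine ⟨U, hUo, ⟨mem_chart_source _ a, Metric.mem_ball_self hr⟩, ?_⟩
  -- the straight-line contraction in the chart
  let k (p : I × U) : EuclideanHalfSpace 3 :=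
    ⟨(1 - (p.1 : ℝ)) • (e a).1 + (p.1 : ℝ) • (e p.2.1).1,
      EuclideanHalfSpace.convex (e a).2 (e p.2.1).2 (by linarith [p.1.2.2]) p.1.2.1 (by ring)⟩
  have hk (p : I × U) : k p ∈ e.target := by
    rw [← hOt]
    refine hrO ?_
    exact (convex_ball _ r) (Metric.mem_ball_self hr) p.2.2.2 (by linarith [p.1.2.2]) p.1.2.1
      (by ring)
  have hec : Continuous fun p : I × U ↦ (e p.2.1).1 := by
    refine continuous_subtype_val.comp ?_
    have := (e.continuousOn.mono Set.inter_subset_left : ContinuousOn e U)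
    exact this.domRestrict.comp continuous_snd
  have hkc : Continuous k := by
    refine Continuous.subtype_mk ?_ _
    fun_prop
  let K : C(I × U, A) := ⟨fun p ↦ e.symm (k p), e.symm.continuousOn.comp_continuous hkc hk⟩
  refine hc.exists_primitive_of_contraction U a K (fun x ↦ ?_) (fun x ↦ ?_)
  · have : k (0, x) = e a := by apply Subtype.ext; simp [k]
    simp only [K, ContinuousMap.coe_mk, this]
    exact e.left_inv (mem_chart_source _ a)
  · have : k (1, x) = e x := by apply Subtype.ext; simp [k]
    simp only [K, ContinuousMap.coe_mk, this]
    exact e.left_inv x.2.1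

/-- Two primitives of a cocycle differ by a locally constant function. -/
lemma eventually_sub_eq_of_primitives [LocallyPathConnectedSpace X] {G : Type*} [AddCommGroup G]
    {c : C(I, X) → G} {U V : Set X} (hU : IsOpen U) (hV : IsOpen V) {g h : X → G}
    (hg : ∀ γ : C(I, X), (∀ t, γ t ∈ U) → c γ = g (γ 1) - g (γ 0))
    (hh : ∀ γ : C(I, X), (∀ t, γ t ∈ V) → c γ = h (γ 1) - h (γ 0)) {x : X} (hx : x ∈ U ∩ V) :
    ∀ᶠ y in 𝓝 x, g y - h y = g x - h x := by
  obtain ⟨W, ⟨hW, hWp⟩, hWs⟩ := (path_connected_basis x).mem_iff.1 ((hU.inter hV).mem_nhds hx)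
  filter_upwards [hW] with y hy
  obtain ⟨γ, hγ⟩ := hWp.joinedIn x (mem_of_mem_nhds hW) y hy
  have h1 := hg γ fun t ↦ (hWs (hγ t)).1
  have h2 := hh γ fun t ↦ (hWs (hγ t)).2
  simp only [ContinuousMap.coe_coe, Path.target, Path.source] at h1 h2
  rw [h1, sub_eq_sub_iff_add_eq_add] at h2
  rw [sub_eq_sub_iff_add_eq_add, h2, add_comm]

/-- Finitely many rational numbers have a common denominator. -/
lemma exists_common_denominator {S : Set ℚ} (hS : S.Finite) :
    ∃ N : ℕ, 0 < N ∧ ∀ q ∈ S, ∃ m : ℤ, N * q = m := by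
  induction S, hS using Set.Finite.induction_on with
  | empty => exact ⟨1, one_pos, by simp⟩
  | @insert q S _ _ ih =>
    obtain ⟨N, hN, h⟩ := ih
    refine ⟨N * q.den, Nat.mul_pos hN q.den_pos, ?_⟩
    rintro r (rfl | hr)
    · refine ⟨N * r.num, ?_⟩
      push_cast
      rw [mul_assoc, Rat.den_mul_eq_num]
    · obtain ⟨m, hm⟩ := h r hr
      refine ⟨m * q.den, ?_⟩
      push_cast
      rw [← hm]
      ring

/-- Over a compact manifold with boundary, a positive multiple of a rational cocycle is
cohomologous, over the reals, to the cocycle of a map to the circle. -/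
theorem exists_circleCochain_eq {A : Type*} [TopologicalSpace A] [T2Space A] [CompactSpace A]
    [ChartedSpace (EuclideanHalfSpace 3) A] (c : C(I, A) → ℚ) (hc : IsPathCocycle c) :
    ∃ (N : ℕ) (f : C(A, UnitAddCircle)) (H : A → ℝ), 0 < N ∧
      ∀ γ, circleCochain f γ = N * c γ - (H (γ 1) - H (γ 0)) := by
  have := ChartedSpace.locallyPathConnectedSpace (EuclideanHalfSpace 3) A
  choose U hUo haU g hg using hc.exists_local_primitive
  have hV (a : A) : ∃ V : Set A, IsOpen V ∧ a ∈ V ∧ closure V ⊆ U a := by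
    obtain ⟨t, ht, htc, hts⟩ := exists_mem_nhds_isClosed_subset ((hUo a).mem_nhds (haU a))
    exact ⟨interior t, isOpen_interior, mem_interior_iff_mem_nhds.2 ht,
      (closure_minimal interior_subset htc).trans hts⟩
  choose V hVo haV hVU using hV
  obtain ⟨T, hT⟩ := isCompact_univ.elim_finite_subcover V hVo
    (fun a _ ↦ Set.mem_iUnion.2 ⟨a, haV a⟩)
  have hTcov : ⋃ i : T, V i = Set.univ := by
    rw [Set.eq_univ_iff_forall]
    intro x
    obtain ⟨i, hi, hx⟩ := Set.mem_iUnion₂.1 (hT (Set.mem_univ x))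
    exact Set.mem_iUnion.2 ⟨⟨i, hi⟩, hx⟩
  -- by compactness two local primitives have only finitely many differences
  have hfin (i j : A) : ((fun x ↦ g i x - g j x) '' (closure (V i) ∩ closure (V j))).Finite := by
    let K : Set A := closure (V i) ∩ closure (V j)
    have : CompactSpace K :=
      isCompact_iff_compactSpace.1 (isClosed_closure.inter isClosed_closure).isCompact
    have hl : IsLocallyConstant fun x : K ↦ g i x - g j x := by
      rw [IsLocallyConstant.iff_eventually_eq]
      intro x
      exact continuous_subtype_val.continuousAt.eventually
        (eventually_sub_eq_of_primitives (hUo i) (hUo j) (hg i) (hg j)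
          ⟨hVU i x.2.1, hVU j x.2.2⟩)
    convert hl.range_finite using 1
    ext y
    simp [K]
  obtain ⟨N, hN, hNint⟩ := exists_common_denominator
    (Set.finite_iUnion fun i : T ↦ Set.finite_iUnion fun j : T ↦ hfin i j)
  have hint (i j : T) (x : A) (hi : x ∈ V i) (hj : x ∈ V j) :
      ∃ m : ℤ, (N : ℝ) * g i x - N * g j x = m := by
    obtain ⟨m, hm⟩ := hNint (g i x - g j x) (Set.mem_iUnion₂.2
      ⟨i, j, x, ⟨subset_closure hi, subset_closure hj⟩, rfl⟩)
    refine ⟨m, ?_⟩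
    rw [← mul_sub]
    exact_mod_cast hm
  obtain ⟨ρ, hρ⟩ := PartitionOfUnity.exists_isSubordinate (isClosed_univ (X := A))
    (fun i : T ↦ V i) (fun i ↦ hVo i) hTcov.ge
  have hρ1 (x : A) : ∑ i : T, ρ i x = 1 := by
    rw [← finsum_eq_sum_of_fintype]
    exact ρ.sum_eq_one (Set.mem_univ x)
  -- the functions `N * g i` agree modulo `1` and become continuous when their average `H` is
  -- subtracted
  let H (x : A) : ℝ := ∑ i : T, ρ i x * (N * g i x)
  have hj (x : A) : ∃ j : T, x ∈ V j := Set.mem_iUnion.1 (hTcov.ge (Set.mem_univ x))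
  choose j hj using hj
  let f₀ (x : A) : UnitAddCircle := ((N * g (j x) x - H x : ℝ) : UnitAddCircle)
  have hf₀ (i : T) (x : A) (hx : x ∈ V i) : f₀ x = ((N * g i x - H x : ℝ) : UnitAddCircle) := by
    obtain ⟨m, hm⟩ := hint (j x) i x (hj x) hx
    exact unitAddCircle_coe_eq_coe.2 ⟨m, by rw [← hm]; ring⟩
  have hcont (i : T) (x : A) (hx : x ∈ V i) :
      ContinuousAt (fun x ↦ (N * g i x - H x : ℝ)) x := by
    have e : (fun x ↦ (N * g i x - H x : ℝ)) =
        fun x ↦ ∑ k : T, ρ k x * (N * ((g i x - g k x : ℚ) : ℝ)) := by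
      funext y
      simp only [H, Rat.cast_sub, mul_sub, Finset.sum_sub_distrib, ← Finset.sum_mul, hρ1, one_mul]
    rw [e]
    refine tendsto_finsetSum _ fun k _ ↦ ?_
    change ContinuousAt (fun x ↦ ρ k x * (N * ((g i x - g k x : ℚ) : ℝ))) x
    by_cases hk : x ∈ tsupport (ρ k)
    · have hkU : x ∈ U k := hVU k (subset_closure (hρ k hk))
      have hev := eventually_sub_eq_of_primitives (hUo i) (hUo k) (hg i) (hg k)
        (x := x) ⟨hVU i (subset_closure hx), hkU⟩
      have : ContinuousAt (fun y ↦ ρ k y * (N * ((g i x - g k x : ℚ) : ℝ))) x := by fun_prop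
      refine this.congr ?_
      filter_upwards [hev] with y hy
      rw [hy]
    · refine (continuousAt_const (y := (0 : ℝ))).congr ?_
      filter_upwards [notMem_tsupport_iff_eventuallyEq.1 hk] with y hy
      simp [hy]
  have hf₀c : Continuous f₀ := by
    refine continuous_iff_continuousAt.2 fun x ↦ ?_
    have : ContinuousAt (fun x ↦ ((N * g (j x) x - H x : ℝ) : UnitAddCircle)) x := by
      have h1 : ContinuousAt (fun y ↦ ((N * g (j x) y - H y : ℝ) : UnitAddCircle)) x :=
        (AddCircle.continuous_mk' (1 : ℝ)).continuousAt.comp (hcont (j x) x (hj x))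
      refine h1.congr ?_
      filter_upwards [(hVo (j x)).mem_nhds (hj x)] with y hy
      exact (hf₀ (j x) y hy).symm
    exact this
  let f : C(A, UnitAddCircle) := ⟨f₀, hf₀c⟩
  refine ⟨N, f, H, hN, fun γ ↦ ?_⟩
  let d (γ : C(I, A)) : ℝ := circleCochain f γ - (N * c γ - (H (γ 1) - H (γ 0)))
  have hd : IsPathCocycle d := by
    intro F p q r
    have h1 := isPathCocycle_circleCochain f F p q r
    have h2 := congrArg (Rat.cast : ℚ → ℝ) (hc F p q r)
    push_cast at h2
    simp only [d, ContinuousMap.comp_apply, squareSegment_apply_one, squareSegment_apply_zero]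
    linear_combination h1 - N * h2
  have hd0 := hd.eq_zero_of_small (fun i : T ↦ V i) (fun i ↦ hVo i) hTcov (fun i γ hγ ↦ ?_) γ
  · simp only [d] at hd0
    linarith
  · have h1 := circleCochain_eq f γ (F := fun t ↦ N * g i (γ t) - H (γ t))
      (continuous_iff_continuousAt.2 fun t ↦
        (hcont i (γ t) (hγ t)).comp γ.continuous.continuousAt) (fun t ↦ (hf₀ i _ (hγ t)).symm)
    have h2 := hg i γ fun t ↦ hVU i (subset_closure (hγ t))
    simp only [d, h1, h2]
    push_cast
    ring

/-- A compact connected manifold with boundary whose first Betti number is positive has a map to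
the circle that is not three times another one. -/
theorem exists_circleMap_not_three_nsmul (A : Type u) [TopologicalSpace A] [T2Space A]
    [CompactSpace A] [PathConnectedSpace A] [ChartedSpace (EuclideanHalfSpace 3) A]
    (hA : 1 ≤ bettiOne A) :
    ∃ f : C(A, UnitAddCircle), ¬ ∃ g : C(A, UnitAddCircle), ∀ x, f x = 3 • g x := by
  obtain ⟨c, hc, hcne⟩ := exists_isPathCocycle_of_one_le_bettiOne hA
  obtain ⟨N, f, H, hN, hf⟩ := exists_circleCochain_eq c hc
  obtain ⟨x₀⟩ : Nonempty A := inferInstance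
  let γ (x : A) : C(I, A) := (PathConnectedSpace.somePath x₀ x : Path x₀ x)
  have hγ0 (x : A) : γ x 0 = x₀ := (PathConnectedSpace.somePath x₀ x).source
  have hγ1 (x : A) : γ x 1 = x := (PathConnectedSpace.somePath x₀ x).target
  obtain ⟨τ, hτ⟩ : ∃ τ, c τ ≠ c (γ (τ 1)) - c (γ (τ 0)) := by
    by_contra! h
    exact hcne ⟨fun x ↦ c (γ x), h⟩
  -- the value of the cocycle of `f` on the closed polygon through `x₀` and `τ`
  let L (f : C(A, UnitAddCircle)) : ℝ :=
    circleCochain f (γ (τ 0)) + circleCochain f τ - circleCochain f (γ (τ 1))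
  have hLint (f) : ∃ n : ℤ, L f = n := by
    have : (L f : UnitAddCircle) = (0 : ℝ) := by
      simp only [L, AddCircle.coe_sub, AddCircle.coe_add, coe_circleCochain, hγ0, hγ1]
      simp
    simpa using unitAddCircle_coe_eq_coe.1 this
  have hL0 : L f ≠ 0 := by
    have : L f = N * ((c (γ (τ 0)) + c τ - c (γ (τ 1)) : ℚ) : ℝ) := by
      simp only [L, hf, hγ0, hγ1]
      push_cast
      ring
    rw [this]
    refine mul_ne_zero (by exact_mod_cast hN.ne') ?_
    rw [Rat.cast_ne_zero]
    intro h0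
    exact hτ (by linarith)
  have hex : ∃ n : ℕ, 0 < n ∧ ∃ f, |L f| = n := by
    obtain ⟨n, hn⟩ := hLint f
    refine ⟨n.natAbs, ?_, f, ?_⟩
    · rw [Int.natAbs_pos]
      rintro rfl
      exact hL0 (by simpa using hn)
    · rw [hn, Nat.cast_natAbs, Int.cast_abs]
  -- a circle map with the smallest positive value of `|L|` is not divisible
  classical
  obtain ⟨hn, f, hfn⟩ := Nat.find_spec hex
  refine ⟨f, fun ⟨g, hg⟩ ↦ ?_⟩
  have h3 : L f = 3 * L g := by
    simp only [L, circleCochain_nsmul 3 f g hg]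
    push_cast
    ring
  obtain ⟨m, hm⟩ := hLint g
  have hlt : m.natAbs < Nat.find hex ∧ 0 < m.natAbs := by
    rw [h3, abs_mul, hm] at hfn
    have : (3 * m.natAbs : ℤ) = Nat.find hex := by
      rw [Nat.cast_natAbs]
      have : (3 : ℝ) * |(m : ℝ)| = Nat.find hex := by simpa using hfn
      exact_mod_cast this
    omega
  exact Nat.find_min hex hlt.1 ⟨hlt.2, g, by rw [hm, Nat.cast_natAbs, Int.cast_abs]⟩

end CircleMaps

/-! ### Products and pullbacks of covering maps -/

section Coverings

open Topology

lemma IsCoveringMap.prodMap {E₁ X₁ E₂ X₂ : Type*} [TopologicalSpace E₁] [TopologicalSpace X₁]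
    [TopologicalSpace E₂] [TopologicalSpace X₂] {p₁ : E₁ → X₁} {p₂ : E₂ → X₂}
    (h₁ : IsCoveringMap p₁) (h₂ : IsCoveringMap p₂) : IsCoveringMap (Prod.map p₁ p₂) := by
  intro x
  obtain ⟨d₁, U₁, hx₁, oU₁, oV₁, H₁, e₁⟩ := h₁ x.1
  obtain ⟨d₂, U₂, hx₂, oU₂, oV₂, H₂, e₂⟩ := h₂ x.2
  refine IsEvenlyCovered.to_isEvenlyCovered_preimage
    (I := (p₁ ⁻¹' {x.1}) × (p₂ ⁻¹' {x.2})) ⟨inferInstance, U₁ ×ˢ U₂, ⟨hx₁, hx₂⟩, oU₁.prod oU₂,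
      oV₁.prod oV₂, ?_⟩
  have k₁ (u : U₁) (i) : p₁ (H₁.symm (u, i)) = u := by rw [← e₁]; simp
  have k₂ (u : U₂) (i) : p₂ (H₂.symm (u, i)) = u := by rw [← e₂]; simp
  exact ⟨{
    toFun z := (⟨(p₁ z.1.1, p₂ z.1.2), z.2⟩,
      ((H₁ ⟨z.1.1, z.2.1⟩).2, (H₂ ⟨z.1.2, z.2.2⟩).2))
    invFun z := ⟨((H₁.symm (⟨z.1.1.1, z.1.2.1⟩, z.2.1)).1, (H₂.symm (⟨z.1.1.2, z.1.2.2⟩, z.2.2)).1),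
      ⟨(H₁.symm _).2, (H₂.symm _).2⟩⟩
    left_inv z := by
      have a₁ := H₁.symm_apply_apply ⟨z.1.1, z.2.1⟩
      have a₂ := H₂.symm_apply_apply ⟨z.1.2, z.2.2⟩
      have b₁ : H₁ ⟨z.1.1, z.2.1⟩ = (⟨p₁ z.1.1, z.2.1⟩, (H₁ ⟨z.1.1, z.2.1⟩).2) :=
        Prod.ext (Subtype.ext (e₁ _)) rfl
      have b₂ : H₂ ⟨z.1.2, z.2.2⟩ = (⟨p₂ z.1.2, z.2.2⟩, (H₂ ⟨z.1.2, z.2.2⟩).2) :=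
        Prod.ext (Subtype.ext (e₂ _)) rfl
      refine Subtype.ext (Prod.ext ?_ ?_)
      · dsimp only
        rw [← b₁, a₁]
      · dsimp only
        rw [← b₂, a₂]
    right_inv z := by
      refine Prod.ext (Subtype.ext (Prod.ext ?_ ?_)) (Prod.ext ?_ ?_)
      · simp [k₁]
      · simp [k₂]
      · simp
      · simp
    continuous_toFun := by
      have c₁ := h₁.continuous
      have c₂ := h₂.continuous
      fun_prop
    continuous_invFun := by fun_prop }, fun z ↦ rfl⟩

/-- The pullback of a covering map along a continuous map is a covering map. -/
lemma IsCoveringMap.pullback_fst {Y X E : Type*} [TopologicalSpace Y] [TopologicalSpace X]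
    [TopologicalSpace E] {p : E → X} (hp : IsCoveringMap p) {r : Y → X} (hr : Continuous r) :
    IsCoveringMap fun z : {z : Y × E // r z.1 = p z.2} ↦ z.1.1 := by
  intro y
  obtain ⟨d, U, hx, oU, oV, H, e⟩ := hp (r y)
  refine IsEvenlyCovered.to_isEvenlyCovered_preimage
    (I := p ⁻¹' {r y}) ⟨d, r ⁻¹' U, hx, oU.preimage hr,
      (oU.preimage hr).preimage (by fun_prop), ?_⟩
  have k (u : U) (i) : p (H.symm (u, i)) = u := by rw [← e]; simp
  have m (z : {z : Y × E // r z.1 = p z.2}) (hz : r z.1.1 ∈ U) : p z.1.2 ∈ U := z.2 ▸ hz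
  exact ⟨{
    toFun z := (⟨z.1.1.1, z.2⟩, (H ⟨z.1.1.2, m z.1 z.2⟩).2)
    invFun z := ⟨⟨(z.1.1, (H.symm (⟨r z.1.1, z.1.2⟩, z.2)).1),
      (k ⟨r z.1.1, z.1.2⟩ z.2).symm⟩, z.1.2⟩
    left_inv z := by
      have b : (⟨r z.1.1.1, z.2⟩, (H ⟨z.1.1.2, m z.1 z.2⟩).2) = H ⟨z.1.1.2, m z.1 z.2⟩ :=
        Prod.ext (Subtype.ext (z.1.2.trans (e ⟨z.1.1.2, m z.1 z.2⟩).symm)) rfl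
      refine Subtype.ext (Subtype.ext (Prod.ext rfl ?_))
      dsimp only
      rw [b, H.symm_apply_apply]
    right_inv z := by
      refine Prod.ext rfl ?_
      simp
    continuous_toFun := by fun_prop
    continuous_invFun := by fun_prop }, fun z ↦ rfl⟩

lemma IsCoveringMap.t2Space {E X : Type*} [TopologicalSpace E] [TopologicalSpace X] [T2Space X]
    {p : E → X} (hp : IsCoveringMap p) : T2Space E := by
  refine ⟨fun x y hxy ↦ ?_⟩
  by_cases h : p x = p y
  · exact hp.isSeparatedMap x y h hxy
  · exact separated_by_continuous hp.continuous h

end Coverings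

/-! ### Connectedness -/

section Connectedness

open Topology

/-- Removing from a preconnected set a closed set that does not separate one of its neighbourhoods
leaves a preconnected set. -/
lemma IsPreconnected.diff_of_diff {X : Type*} [TopologicalSpace X] {S D W : Set X}
    (hS : IsPreconnected S) (hD : IsClosed D) (hW : IsOpen W) (hDW : D ⊆ W)
    (hWS : W ⊆ S) (h : IsPreconnected (W \ D)) : IsPreconnected (S \ D) := by
  have key (u v : Set X) (hu : IsOpen u) (hv : IsOpen v) (hsub : S \ D ⊆ u ∪ v)
      (hdis : S \ D ∩ (u ∩ v) = ∅) (hWu : W \ D ⊆ u) : S \ D ⊆ u ∨ S \ D ⊆ v := by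
    rw [isPreconnected_iff_subset_of_disjoint] at hS
    have hdis' (x) (hx : x ∈ S) (hD : x ∉ D) (hu : x ∈ u) (hv : x ∈ v) : False := by
      have : x ∈ S \ D ∩ (u ∩ v) := ⟨⟨hx, hD⟩, hu, hv⟩
      rwa [hdis] at this
    have hc : S ⊆ (u ∪ W) ∪ (v \ D) := fun x hx ↦ by
      by_cases hxD : x ∈ D
      · exact .inl (.inr (hDW hxD))
      · exact (hsub ⟨hx, hxD⟩).elim (fun h ↦ .inl (.inl h)) fun h ↦ .inr ⟨h, hxD⟩
    have he : S ∩ ((u ∪ W) ∩ (v \ D)) = ∅ := by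
      refine Set.eq_empty_of_forall_notMem ?_
      rintro x ⟨hx, hxu, hxv, hxD⟩
      exact hdis' x hx hxD (hxu.elim id fun hxW ↦ hWu ⟨hxW, hxD⟩) hxv
    refine (hS _ _ (hu.union hW) (hv.sdiff hD) hc he).imp ?_ ?_
    · rintro h x ⟨hx, hxD⟩
      exact (h hx).elim id fun hxW ↦ hWu ⟨hxW, hxD⟩
    · rintro h x ⟨hx, hxD⟩
      exact (h hx).1
  have hsub' : W \ D ⊆ S \ D := Set.sdiff_subset_sdiff_left hWS
  rw [isPreconnected_iff_subset_of_disjoint] at h ⊢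
  intro u v hu hv hsub hdis
  rcases h u v hu hv (hsub'.trans hsub)
    (Set.subset_eq_empty (Set.inter_subset_inter_left _ hsub') hdis) with h | h
  · exact key u v hu hv hsub hdis h
  · exact (key v u hv hu (Set.union_comm u v ▸ hsub) (Set.inter_comm u v ▸ hdis) h).symm

/-- A closed map with connected fibres pulls preconnected sets back to preconnected sets; here the
map is the projection of a fibre product with compact first factor. -/
lemma isPreconnected_fiberProduct {M E Y : Type*} [TopologicalSpace M] [CompactSpace M]
    [TopologicalSpace E] [TopologicalSpace Y] [T2Space Y] {N : Set M} (hN : IsClosed N)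
    {r : M → Y} (hr : Continuous r) {p : E → Y} (hp : Continuous p) {S : Set E}
    (hS : IsPreconnected S) (hfib : ∀ e ∈ S, IsConnected {x ∈ N | r x = p e}) :
    IsPreconnected {z : M × E | z.1 ∈ N ∧ r z.1 = p z.2 ∧ z.2 ∈ S} := by
  rw [isPreconnected_iff_subset_of_disjoint_closed] at hS ⊢
  intro u v hu hv huv hdis
  have hZ : IsClosed {z : M × E | z.1 ∈ N ∧ r z.1 = p z.2} :=
    (hN.preimage continuous_fst).inter (isClosed_eq (by fun_prop) (by fun_prop))
  have hcl (w : Set (M × E)) (hw : IsClosed w) :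
      IsClosed (Prod.snd '' ({z : M × E | z.1 ∈ N ∧ r z.1 = p z.2} ∩ w)) :=
    isClosedMap_snd_of_compactSpace _ (hZ.inter hw)
  have hd (e) (he : e ∈ S)
      (h₁ : e ∈ Prod.snd '' ({z : M × E | z.1 ∈ N ∧ r z.1 = p z.2} ∩ u))
      (h₂ : e ∈ Prod.snd '' ({z : M × E | z.1 ∈ N ∧ r z.1 = p z.2} ∩ v)) : False := by
    obtain ⟨⟨x, _⟩, ⟨hx, hxu⟩, rfl⟩ := h₁
    obtain ⟨⟨y, e⟩, ⟨hy, hyv⟩, rfl⟩ := h₂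
    have hc := (hfib e he).isPreconnected
    rw [isPreconnected_closed_iff] at hc
    have hi : Continuous fun x : M ↦ (x, e) := by fun_prop
    obtain ⟨t, ht, htu, htv⟩ := hc _ _ (hu.preimage hi) (hv.preimage hi)
      (fun t ht ↦ huv ⟨ht.1, ht.2, he⟩) ⟨x, hx, hxu⟩ ⟨y, hy, hyv⟩
    have : (t, e) ∈ {z : M × E | z.1 ∈ N ∧ r z.1 = p z.2 ∧ z.2 ∈ S} ∩ (u ∩ v) :=
      ⟨⟨ht.1, ht.2, he⟩, htu, htv⟩
    rwa [hdis] at this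
  have hc : S ⊆ Prod.snd '' ({z : M × E | z.1 ∈ N ∧ r z.1 = p z.2} ∩ u) ∪
      Prod.snd '' ({z : M × E | z.1 ∈ N ∧ r z.1 = p z.2} ∩ v) := fun e he ↦ by
    obtain ⟨x, hx⟩ := (hfib e he).nonempty
    have hz : (x, e) ∈ {z : M × E | z.1 ∈ N ∧ r z.1 = p z.2 ∧ z.2 ∈ S} := ⟨hx.1, hx.2, he⟩
    exact (huv hz).imp (fun h ↦ ⟨_, ⟨⟨hx.1, hx.2⟩, h⟩, rfl⟩) (fun h ↦ ⟨_, ⟨⟨hx.1, hx.2⟩, h⟩, rfl⟩)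
  refine (hS _ _ (hcl u hu) (hcl v hv) hc
    (Set.eq_empty_of_forall_notMem fun e he ↦ hd e he.1 he.2.1 he.2.2)).imp ?_ ?_
  · intro h z hz
    refine (huv hz).elim id fun hzv ↦ ?_
    exact (hd z.2 hz.2.2 (h hz.2.2) ⟨z, ⟨⟨hz.1, hz.2.1⟩, hzv⟩, rfl⟩).elim
  · intro h z hz
    refine (huv hz).elim (fun hzu ↦ ?_) id
    exact (hd z.2 hz.2.2 ⟨z, ⟨⟨hz.1, hz.2.1⟩, hzu⟩, rfl⟩ (h hz.2.2)).elim

end Connectedness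

/-! ### The triple cover defined by a map to the circle -/

section TripleCover

open Topology

lemma three_nsmul_third : 3 • ((1 / 3 : ℝ) : UnitAddCircle) = 0 := by
  rw [← AddCircle.coe_nsmul, AddCircle.coe_eq_zero_iff]
  exact ⟨1, by norm_num⟩

lemma eq_of_three_nsmul_eq_zero {x : UnitAddCircle} (h : 3 • x = 0) :
    x = 0 ∨ x = ((1 / 3 : ℝ) : UnitAddCircle) ∨
      x = ((1 / 3 : ℝ) : UnitAddCircle) + ((1 / 3 : ℝ) : UnitAddCircle) := by
  obtain ⟨t, rfl⟩ := QuotientAddGroup.mk_surjective x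
  change 3 • (t : UnitAddCircle) = 0 at h
  rw [← AddCircle.coe_nsmul, AddCircle.coe_eq_zero_iff] at h
  obtain ⟨n, hn⟩ := h
  have hn : (n : ℝ) = 3 * t := by simpa using hn
  have key (k : ℤ) (hk : n % 3 = k) :
      ((t : ℝ) : UnitAddCircle) = ((k / 3 : ℝ) : UnitAddCircle) := by
    rw [unitAddCircle_coe_eq_coe]
    refine ⟨n / 3, ?_⟩
    have := Int.emod_add_mul_ediv n 3
    rw [hk] at this
    have : (n : ℝ) = k + 3 * (n / 3 : ℤ) := by exact_mod_cast this.symm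
    linarith
  change (t : UnitAddCircle) = _ ∨ (t : UnitAddCircle) = _ ∨ (t : UnitAddCircle) = _
  have : n % 3 = 0 ∨ n % 3 = 1 ∨ n % 3 = 2 := by omega
  rcases this with h | h | h
  · left; simpa using key 0 h
  · right; left; simpa using key 1 h
  · right; right
    rw [key 2 h, ← AddCircle.coe_add]
    norm_num

lemma third_ne_zero : ((1 / 3 : ℝ) : UnitAddCircle) ≠ 0 := by
  intro h
  rw [← AddCircle.coe_zero, unitAddCircle_coe_eq_coe] at h
  obtain ⟨n, hn⟩ := h
  have h1 : (0 : ℝ) < n := by rw [← hn]; norm_num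
  have h2 : (n : ℝ) < 1 := by rw [← hn]; norm_num
  have h1 : 0 < n := by exact_mod_cast h1
  have h2 : n < 1 := by exact_mod_cast h2
  omega

lemma third_add_third_ne_zero :
    ((1 / 3 : ℝ) : UnitAddCircle) + ((1 / 3 : ℝ) : UnitAddCircle) ≠ 0 := by
  intro h
  have := three_nsmul_third
  rw [show 3 • ((1 / 3 : ℝ) : UnitAddCircle) = ((1 / 3 : ℝ) : UnitAddCircle) +
    ((1 / 3 : ℝ) : UnitAddCircle) + ((1 / 3 : ℝ) : UnitAddCircle) by abel, h, zero_add] at this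
  exact third_ne_zero this

lemma exists_three_nsmul_eq (y : UnitAddCircle) : ∃ s : UnitAddCircle, 3 • s = y := by
  obtain ⟨t, rfl⟩ := QuotientAddGroup.mk_surjective y
  refine ⟨((t / 3 : ℝ) : UnitAddCircle), ?_⟩
  rw [← AddCircle.coe_nsmul]
  change _ = (t : UnitAddCircle)
  congr 1
  simp
  ring

lemma card_three_nsmul_eq (y : UnitAddCircle) :
    Nat.card ((3 • ·) ⁻¹' {y} : Set UnitAddCircle) = 3 := by
  obtain ⟨s, rfl⟩ := exists_three_nsmul_eq y
  set w := ((1 / 3 : ℝ) : UnitAddCircle) with hw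
  have h3 : 3 • w = 0 := three_nsmul_third
  have hset : ((3 • ·) ⁻¹' {3 • s} : Set UnitAddCircle) = {s, s + w, s + (w + w)} := by
    ext x
    simp only [Set.mem_preimage, Set.mem_singleton_iff, Set.mem_insert_iff]
    constructor
    · intro h
      have : 3 • (x - s) = 0 := by rw [smul_sub, h, sub_self]
      rcases eq_of_three_nsmul_eq_zero this with h | h | h
      · left; exact sub_eq_zero.mp h
      · right; left; rw [← hw] at h; rw [← h]; abel
      · right; right; rw [← hw] at h; rw [← h]; abel
    · rintro (rfl | rfl | rfl)
      · rfl
      · rw [smul_add, h3, add_zero]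
      · rw [smul_add, smul_add, h3, add_zero, add_zero]
  rw [hset, Nat.card_coe_set_eq, Set.ncard_eq_three]
  refine ⟨s, s + w, s + (w + w), ?_, ?_, ?_, rfl⟩
  · exact fun h ↦ third_ne_zero (by simpa only [left_eq_add] using h)
  · exact fun h ↦ third_add_third_ne_zero (by simpa only [left_eq_add] using h)
  · exact fun h ↦ third_ne_zero (by simpa only [add_right_inj, left_eq_add] using h)

lemma isCoveringMap_three_nsmul : IsCoveringMap fun s : UnitAddCircle ↦ 3 • s :=
  (AddCircle.isAddQuotientCoveringMap_nsmul_of_ne_zero (1 : ℝ) 3).isCoveringMap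

/-- A clopen set of the triple cover `{(a, s) | f a = 3 • s}` that meets each fibre in one point is
the graph of a continuous cube root of `f`. -/
lemma exists_three_nsmul_of_isClopen {A : Type*} [TopologicalSpace A] {f : A → UnitAddCircle}
    (hf : Continuous f) {C : Set {z : A × UnitAddCircle // f z.1 = 3 • z.2}} (hC : IsClopen C)
    (h : ∀ a, ∃! z, z ∈ C ∧ z.1.1 = a) :
    ∃ g : C(A, UnitAddCircle), ∀ a, f a = 3 • g a := by
  have hopen := (isCoveringMap_three_nsmul.pullback_fst hf).isOpenMap
  choose z hz huniq using fun a ↦ (h a)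
  refine ⟨⟨fun a ↦ (z a).1.2, continuous_def.mpr fun O hO ↦ ?_⟩, fun a ↦ ?_⟩
  · convert hopen _ (hC.isOpen.inter (hO.preimage (continuous_snd.comp continuous_subtype_val)))
    ext a
    simp only [Set.mem_preimage, Set.mem_image, Set.mem_inter_iff, Function.comp_apply]
    constructor
    · intro ha
      exact ⟨z a, ⟨(hz a).1, ha⟩, (hz a).2⟩
    · rintro ⟨y, ⟨hy, hyO⟩, hya⟩
      rwa [← huniq a y ⟨hy, hya⟩]
  · have := (z a).2
    rwa [(hz a).2] at this

/-- The triple cover `{(a, s) | f a = 3 • s}` is connected unless `f` has a continuous cube root: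
for a clopen set, the number of its points in a fibre is constant, and if this number is `1` or `2`,
the set or its complement is the graph of a cube root. -/
lemma preconnectedSpace_tripleCover {A : Type*} [TopologicalSpace A] [PreconnectedSpace A]
    (f : C(A, UnitAddCircle)) (h : ¬ ∃ g : C(A, UnitAddCircle), ∀ a, f a = 3 • g a) :
    PreconnectedSpace {z : A × UnitAddCircle // f z.1 = 3 • z.2} := by
  classical
  set T := {z : A × UnitAddCircle // f z.1 = 3 • z.2}
  have hcov := isCoveringMap_three_nsmul.pullback_fst f.continuous
  have hsurj (a : A) : ∃ z : T, z.1.1 = a := by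
    obtain ⟨s, hs⟩ := exists_three_nsmul_eq (f a)
    exact ⟨⟨(a, s), hs.symm⟩, rfl⟩
  -- the deck transformation
  let τ : T → T := fun z ↦ ⟨(z.1.1, z.1.2 + ((1 / 3 : ℝ) : UnitAddCircle)), by
    rw [smul_add, three_nsmul_third, add_zero]; exact z.2⟩
  have hτ : Continuous τ := by fun_prop
  have hτ3 (z : T) : τ (τ (τ z)) = z := by
    refine Subtype.ext (Prod.ext rfl ?_)
    have := three_nsmul_third
    rw [show 3 • ((1 / 3 : ℝ) : UnitAddCircle) = ((1 / 3 : ℝ) : UnitAddCircle) +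
      ((1 / 3 : ℝ) : UnitAddCircle) + ((1 / 3 : ℝ) : UnitAddCircle) by abel] at this
    change z.1.2 + ((1 / 3 : ℝ) : UnitAddCircle) + ((1 / 3 : ℝ) : UnitAddCircle) +
      ((1 / 3 : ℝ) : UnitAddCircle) = _
    rw [add_assoc, add_assoc, ← add_assoc ((1 / 3 : ℝ) : UnitAddCircle), this, add_zero]
  have hτ1 (z : T) : τ z ≠ z := by
    intro e
    have : z.1.2 + ((1 / 3 : ℝ) : UnitAddCircle) = z.1.2 := congrArg (fun z : T ↦ z.1.2) e
    exact third_ne_zero (by simpa using this)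
  have hfib (z y : T) (e : y.1.1 = z.1.1) : y = z ∨ y = τ z ∨ y = τ (τ z) := by
    have h3 : 3 • (y.1.2 - z.1.2) = 0 := by
      rw [smul_sub, ← y.2, ← z.2, e, sub_self]
    rcases eq_of_three_nsmul_eq_zero h3 with h | h | h
    · left; exact Subtype.ext (Prod.ext e (sub_eq_zero.mp h))
    · right; left
      refine Subtype.ext (Prod.ext e ?_)
      change y.1.2 = z.1.2 + _
      rw [← h]; abel
    · right; right
      refine Subtype.ext (Prod.ext e ?_)
      change y.1.2 = z.1.2 + _ + _
      rw [add_assoc, ← h]; abel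
  -- a nonempty invariant clopen set is the preimage of a clopen set of the base
  have hinv (S : Set T) (hS : IsClopen S) (hSτ : ∀ z ∈ S, τ z ∈ S) (hne : S.Nonempty) (z : T) :
      z ∈ S := by
    have hS' (z y : T) (e : y.1.1 = z.1.1) (hz : z ∈ S) : y ∈ S := by
      rcases hfib z y e with rfl | rfl | rfl
      exacts [hz, hSτ _ hz, hSτ _ (hSτ _ hz)]
    have hcl : IsClopen ((fun z : T ↦ z.1.1) '' S) := by
      refine ⟨⟨?_⟩, hcov.isOpenMap _ hS.isOpen⟩
      convert hcov.isOpenMap _ hS.compl.isOpen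
      ext a
      constructor
      · intro ha
        obtain ⟨y, hy⟩ := hsurj a
        exact ⟨y, fun hyS ↦ ha ⟨y, hyS, hy⟩, hy⟩
      · rintro ⟨y, hy, rfl⟩ ⟨w, hw, e⟩
        exact hy (hS' w y e.symm hw)
    have huniv := hcl.eq_univ (hne.image _)
    obtain ⟨w, hw, e⟩ : z.1.1 ∈ (fun z : T ↦ z.1.1) '' S := huniv ▸ Set.mem_univ _
    exact hS' w z e.symm hw
  rw [preconnectedSpace_iff_clopen]
  intro C hC
  -- a clopen set with exactly one point in some fibre has exactly one point in each fibre
  have hone (C : Set T) (hC : IsClopen C) (z : T) (h0 : z ∈ C) (h1 : τ z ∉ C) (h2 : τ (τ z) ∉ C) :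
      False := by
    have hC1 : IsClopen (τ ⁻¹' C) := hC.preimage hτ
    have hC2 : IsClopen (τ ⁻¹' (τ ⁻¹' C)) := hC1.preimage hτ
    -- the points whose fibre meets `C` in exactly one point
    let S : Set T := (C ∩ ((τ ⁻¹' C)ᶜ ∩ (τ ⁻¹' (τ ⁻¹' C))ᶜ)) ∪
      ((Cᶜ ∩ (τ ⁻¹' C ∩ (τ ⁻¹' (τ ⁻¹' C))ᶜ)) ∪ (Cᶜ ∩ ((τ ⁻¹' C)ᶜ ∩ (τ ⁻¹' (τ ⁻¹' C)))))
    have hS : IsClopen S := (hC.inter (hC1.compl.inter hC2.compl)).union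
      ((hC.compl.inter (hC1.inter hC2.compl)).union (hC.compl.inter (hC1.compl.inter hC2)))
    have hall := hinv S hS (fun z hz ↦ by
      simp only [S, Set.mem_union, Set.mem_inter_iff, Set.mem_compl_iff, Set.mem_preimage,
        hτ3] at hz ⊢
      tauto) ⟨z, .inl ⟨h0, h1, h2⟩⟩
    refine h (exists_three_nsmul_of_isClopen f.continuous hC fun a ↦ ?_)
    obtain ⟨y, rfl⟩ := hsurj a
    have hy := hall y
    have aux (w : T) (hw : w ∈ C) (hw1 : τ w ∉ C) (hw2 : τ (τ w) ∉ C) :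
        ∃! z, z ∈ C ∧ z.1.1 = w.1.1 := by
      refine ⟨w, ⟨hw, rfl⟩, fun v hv ↦ ?_⟩
      rcases hfib w v hv.2 with rfl | rfl | rfl
      exacts [rfl, (hw1 hv.1).elim, (hw2 hv.1).elim]
    rcases hy with hy | hy | hy
    · exact aux y hy.1 hy.2.1 hy.2.2
    · exact aux (τ y) hy.2.1 hy.2.2 (by rw [hτ3]; exact hy.1)
    · exact aux (τ (τ y)) hy.2.2 (by rw [hτ3]; exact hy.1) (by rw [hτ3]; exact hy.2.1)
  by_contra! hcon
  obtain ⟨⟨z, hz⟩, hne⟩ := hcon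
  have htwo (z : T) (h0 : z ∉ C) (h1 : τ z ∈ C) : False := by
    by_cases h2 : τ (τ z) ∈ C
    · exact hone Cᶜ hC.compl z h0 (by simpa using h1) (by simpa using h2)
    · exact hone C hC (τ z) h1 h2 (by rw [hτ3]; exact h0)
  refine hne (Set.eq_univ_of_forall (hinv C hC (fun z hz ↦ ?_) ⟨z, hz⟩))
  by_contra h1
  by_cases h2 : τ (τ z) ∈ C
  · exact htwo (τ z) h1 h2
  · exact htwo (τ (τ z)) h2 (by rw [hτ3]; exact hz)

end TripleCover

/-! ### Smooth structures on covering spaces -/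

section PullbackStructure

open Topology

variable {H : Type*} [TopologicalSpace H] {X Y : Type*} [TopologicalSpace X] [TopologicalSpace Y]
  [ChartedSpace H Y] {p : X → Y}

/-- A chart at `x` for the structure pulled back along a local homeomorphism `p`: a local inverse
branch of `p` followed by the preferred chart at `p x`. -/
noncomputable def IsLocalHomeomorph.pullbackChart (hp : IsLocalHomeomorph p) (x : X) :
    OpenPartialHomeomorph X H :=
  (hp x).choose.trans (chartAt H (p x))

lemma IsLocalHomeomorph.mem_pullbackChart_source (hp : IsLocalHomeomorph p) (x : X) :
    x ∈ (hp.pullbackChart (H := H) x).source := by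
  refine ⟨(hp x).choose_spec.1, ?_⟩
  change (hp x).choose x ∈ (chartAt H (p x)).source
  rw [← (hp x).choose_spec.2]
  exact mem_chart_source H (p x)

lemma IsLocalHomeomorph.pullbackChart_apply (hp : IsLocalHomeomorph p) (x y : X) :
    hp.pullbackChart (H := H) x y = chartAt H (p x) (p y) := by
  change chartAt H (p x) ((hp x).choose y) = _
  rw [← (hp x).choose_spec.2]

lemma IsLocalHomeomorph.apply_mem_source (hp : IsLocalHomeomorph p) (x : X) {y : X}
    (hy : y ∈ (hp.pullbackChart (H := H) x).source) : p y ∈ (chartAt H (p x)).source := by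
  have h : (hp x).choose y ∈ (chartAt H (p x)).source := hy.2
  rwa [← (hp x).choose_spec.2] at h

lemma IsLocalHomeomorph.pullbackChart_target (hp : IsLocalHomeomorph p) (x : X) :
    (hp.pullbackChart (H := H) x).target ⊆ (chartAt H (p x)).target := fun _ h ↦ h.1

lemma IsLocalHomeomorph.apply_pullbackChart_symm (hp : IsLocalHomeomorph p) (x : X) {z : H}
    (hz : z ∈ (hp.pullbackChart (H := H) x).target) :
    p ((hp.pullbackChart (H := H) x).symm z) = (chartAt H (p x)).symm z := by
  have h := (hp.pullbackChart (H := H) x).right_inv hz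
  rw [hp.pullbackChart_apply] at h
  rw [← h, (chartAt H (p x)).left_inv
    (hp.apply_mem_source x ((hp.pullbackChart (H := H) x).map_target hz)), h]

/-- The charted space structure on `X` for which `p : X → Y` is a local isomorphism. -/
noncomputable abbrev IsLocalHomeomorph.pullbackChartedSpace (hp : IsLocalHomeomorph p) :
    ChartedSpace H X where
  atlas := Set.range hp.pullbackChart
  chartAt := hp.pullbackChart
  mem_chart_source := hp.mem_pullbackChart_source
  chart_mem_atlas x := ⟨x, rfl⟩

variable {E : Type*} [NormedAddCommGroup E] [NormedSpace ℝ E] (I : ModelWithCorners ℝ E H)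
  {n : WithTop ℕ∞}

lemma IsLocalHomeomorph.isManifold_pullback [IsManifold I n Y] (hp : IsLocalHomeomorph p) :
    letI := hp.pullbackChartedSpace (H := H)
    IsManifold I n X := by
  let := hp.pullbackChartedSpace (H := H)
  have : HasGroupoid X (contDiffGroupoid n I) := by
    refine ⟨?_⟩
    rintro _ _ ⟨x, rfl⟩ ⟨y, rfl⟩
    set e := hp.pullbackChart (H := H) x
    set e' := hp.pullbackChart (H := H) y
    have hG := (contDiffGroupoid n I).compatible (chart_mem_atlas H (p x)) (chart_mem_atlas H (p y))
    refine (contDiffGroupoid n I).mem_of_eqOnSource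
      (closedUnderRestriction' hG (e.symm.trans e').open_source) ⟨?_, ?_⟩
    · rw [OpenPartialHomeomorph.restr_source, (e.symm.trans e').open_source.interior_eq,
        eq_comm, Set.inter_eq_right]
      rintro z ⟨hz, hz'⟩
      refine ⟨hp.pullbackChart_target x hz, ?_⟩
      have := hp.apply_mem_source y hz'
      change (chartAt H (p x)).symm z ∈ (chartAt H (p y)).source
      rwa [← hp.apply_pullbackChart_symm x hz]
    · rintro z ⟨hz, hz'⟩
      change e' (e.symm z) = chartAt H (p y) ((chartAt H (p x)).symm z)
      rw [← hp.apply_pullbackChart_symm x hz, hp.pullbackChart_apply]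
  exact IsManifold.mk' _ _ _

lemma IsLocalHomeomorph.isLocalDiffeomorph_pullback [IsManifold I n Y] (hp : IsLocalHomeomorph p) :
    letI := hp.pullbackChartedSpace (H := H)
    IsLocalDiffeomorph I I n p := by
  let := hp.pullbackChartedSpace (H := H)
  have := hp.isManifold_pullback I (n := n)
  intro x
  have he : hp.pullbackChart (H := H) x ∈ IsManifold.maximalAtlas I n X :=
    IsManifold.chart_mem_maximalAtlas (H := H) x
  have hc : chartAt H (p x) ∈ IsManifold.maximalAtlas I n Y := IsManifold.chart_mem_maximalAtlas _
  let Φ := (hp.pullbackChart (H := H) x).trans (chartAt H (p x)).symm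
  refine ⟨{ Φ.toPartialEquiv with
      open_source := Φ.open_source
      open_target := Φ.open_target
      contMDiffOn_toFun := (contMDiffOn_symm_of_mem_maximalAtlas hc).comp
        ((contMDiffOn_of_mem_maximalAtlas he).mono Set.inter_subset_left) fun y hy ↦ hy.2
      contMDiffOn_invFun := (contMDiffOn_symm_of_mem_maximalAtlas he).comp
        ((contMDiffOn_of_mem_maximalAtlas hc).mono Set.inter_subset_left) fun y hy ↦ hy.2 }, ?_, ?_⟩
  · refine ⟨hp.mem_pullbackChart_source x, ?_⟩
    change hp.pullbackChart (H := H) x x ∈ (chartAt H (p x)).target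
    exact hp.pullbackChart_target x ((hp.pullbackChart (H := H) x).map_source
      (hp.mem_pullbackChart_source x))
  · rintro y ⟨hy, hy'⟩
    change p y = (chartAt H (p x)).symm (hp.pullbackChart (H := H) x y)
    rw [hp.pullbackChart_apply, (chartAt H (p x)).left_inv (hp.apply_mem_source x hy)]

end PullbackStructure

/-! ### Round spheres in a chart are immersed -/

section Spheres

open Topology

/-- The inclusion of the open half-space into the half-space with boundary, as a partial
diffeomorphism. -/
noncomputable def halfSpaceInclusion :
    PartialDiffeomorph (𝓡 3) (𝓡∂ 3) E3 (EuclideanHalfSpace 3) ∞ where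
  toFun := (𝓡∂ 3).symm
  invFun := (𝓡∂ 3)
  source := {x | 0 < x 0}
  target := {z | 0 < z.1 0}
  map_source' x hx := by
    change 0 < ((𝓡∂ 3) ((𝓡∂ 3).symm x)) 0
    rw [(𝓡∂ 3).right_inv]
    · exact hx
    · rw [range_modelWithCornersEuclideanHalfSpace]
      exact (show (0 : ℝ) < x 0 from hx).le
  map_target' z hz := hz
  left_inv' x hx := (𝓡∂ 3).right_inv (by
    rw [range_modelWithCornersEuclideanHalfSpace]
    exact (show (0 : ℝ) < x 0 from hx).le)
  right_inv' z _ := (𝓡∂ 3).left_inv z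
  open_source := isOpen_lt continuous_const (by fun_prop)
  open_target := isOpen_lt continuous_const
    ((by fun_prop : Continuous fun x : E3 ↦ x 0).comp continuous_subtype_val)
  contMDiffOn_toFun := (ModelWithCorners.contMDiffOn_symm _).mono fun x hx ↦ by
    rw [range_modelWithCornersEuclideanHalfSpace]
    exact (show (0 : ℝ) < x 0 from hx).le
  contMDiffOn_invFun := (ModelWithCorners.contMDiff _).contMDiffOn

/-- Splitting off the last coordinate of `ℝ³`. -/
noncomputable def splitLast : (EuclideanSpace ℝ (Fin 2) × ℝ) ≃L[ℝ] E3 :=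
  LinearEquiv.toContinuousLinearEquiv {
    toFun z := !₂[z.1 0, z.1 1, z.2]
    invFun x := (!₂[x 0, x 1], x 2)
    map_add' z w := by ext i; fin_cases i <;> simp
    map_smul' c z := by ext i; fin_cases i <;> simp
    left_inv z := by
      refine Prod.ext ?_ ?_
      · ext i; fin_cases i <;> simp
      · simp
    right_inv x := by ext i; fin_cases i <;> simp }

lemma splitLast_apply_zero (z : EuclideanSpace ℝ (Fin 2) × ℝ) : splitLast z 0 = z.1 0 := by
  simp [splitLast]

instance : Fact (Module.finrank ℝ E3 = 2 + 1) := ⟨by simp⟩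

open Classical in
/-- The radial projection to the unit sphere, with a junk value at the origin. -/
noncomputable def radialProj (v : S2) (x : E3) : S2 :=
  if hx : x = 0 then v else ⟨‖x‖⁻¹ • x, by simp [norm_smul, hx]⟩

lemma coe_radialProj (v : S2) {x : E3} (hx : x ≠ 0) : (radialProj v x : E3) = ‖x‖⁻¹ • x := by
  simp [radialProj, hx]

lemma radialProj_smul (v w : S2) {t : ℝ} (ht : 0 < t) : radialProj v (t • (w : E3)) = w := by
  have hw : ‖(w : E3)‖ = 1 := by simp
  have hw0 : (w : E3) ≠ 0 := fun h ↦ by simp [h] at hw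
  refine Subtype.ext ?_
  rw [coe_radialProj v (smul_ne_zero ht.ne' hw0), norm_smul, hw, smul_smul, mul_one,
    Real.norm_of_nonneg ht.le, inv_mul_cancel₀ ht.ne', one_smul]

lemma contMDiffOn_radialProj (v : S2) :
    ContMDiffOn (𝓡 3) (𝓡 2) ∞ (radialProj v) {x | x ≠ 0} := by
  let U : TopologicalSpace.Opens E3 := ⟨{x | x ≠ 0}, isOpen_ne⟩
  have h0 : ContMDiff (𝓡 3) (𝓡 3) ∞ (fun x : U ↦ ‖(x : E3)‖⁻¹ • (x : E3)) := by
    intro x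
    refine (contMDiffAt_subtype_iff (f := fun x : E3 ↦ ‖x‖⁻¹ • x)).mpr ?_
    have hx : (x : E3) ≠ 0 := x.2
    exact (((contDiffAt_norm ℝ hx).inv (norm_ne_zero_iff.mpr hx)).smul contDiffAt_id).contMDiffAt
  have h1 : ContMDiff (𝓡 3) (𝓡 2) ∞ (fun x : U ↦ radialProj v x) := by
    refine (h0.codRestrict_sphere (n := 2) (fun x ↦ by
      have hx : (x : E3) ≠ 0 := x.2
      simp [norm_smul, hx])).congr fun x ↦ ?_
    exact Subtype.ext (coe_radialProj v x.2)
  intro x hx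
  exact (contMDiffAt_subtype_iff (U := U) (x := ⟨x, hx⟩).mp (h1 ⟨x, hx⟩)).contMDiffWithinAt

/-- Polar coordinates on `ℝ³` around the sphere of radius `r`, in which the sphere becomes a plane;
the angular coordinates are read in a chart `e` of the unit sphere. The point `v` is the junk value
of the radial projection and plays no role on the domain. -/
noncomputable def polarCoordinates (v : S2) (r : ℝ)
    (e : OpenPartialHomeomorph S2 (EuclideanSpace ℝ (Fin 2)))
    (he : e ∈ IsManifold.maximalAtlas (𝓡 2) ∞ S2) :
    PartialDiffeomorph (𝓡 3) (𝓡 3) E3 E3 ∞ where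
  toFun x := splitLast (e (radialProj v x), ‖x‖ - r)
  invFun y := ((splitLast.symm y).2 + r) • (e.symm (splitLast.symm y).1 : E3)
  source := {x | x ≠ 0} ∩ radialProj v ⁻¹' e.source
  target := {y | (splitLast.symm y).1 ∈ e.target ∧ 0 < (splitLast.symm y).2 + r}
  map_source' x hx := by
    have hx0 : x ≠ 0 := hx.1
    simpa [hx0] using e.map_source hx.2
  map_target' y hy := by
    set w := e.symm (splitLast.symm y).1
    have hw : ‖(w : E3)‖ = 1 := by simp
    have hw0 : (w : E3) ≠ 0 := fun h ↦ by simp [h] at hw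
    refine ⟨smul_ne_zero hy.2.ne' hw0, ?_⟩
    rw [Set.mem_preimage, radialProj_smul v w hy.2]
    exact e.map_target hy.1
  left_inv' x hx := by
    have hx0 : ‖x‖ ≠ 0 := norm_ne_zero_iff.mpr hx.1
    simp only [ContinuousLinearEquiv.symm_apply_apply, sub_add_cancel]
    rw [e.left_inv hx.2, coe_radialProj v hx.1, smul_smul, mul_inv_cancel₀ hx0, one_smul]
  right_inv' y hy := by
    set w := e.symm (splitLast.symm y).1 with hw'
    have hw : ‖(w : E3)‖ = 1 := by simp
    rw [radialProj_smul v w hy.2, norm_smul, hw, mul_one, Real.norm_of_nonneg hy.2.le,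
      add_sub_cancel_right, hw', e.right_inv hy.1]
    simp
  open_source :=
    (contMDiffOn_radialProj v).continuousOn.isOpen_inter_preimage isOpen_ne e.open_source
  open_target := (e.open_target.preimage
    (by fun_prop : Continuous fun y : E3 ↦ (splitLast.symm y).1)).inter (isOpen_lt continuous_const
      (by fun_prop : Continuous fun y : E3 ↦ (splitLast.symm y).2 + r))
  contMDiffOn_toFun := by
    refine splitLast.contDiff.contMDiff.comp_contMDiffOn (ContMDiffOn.prodMk_space ?_ ?_)
    · exact (contMDiffOn_of_mem_maximalAtlas he).comp
        ((contMDiffOn_radialProj v).mono Set.inter_subset_left) Set.inter_subset_right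
    · exact fun x hx ↦
        ((contDiffAt_norm ℝ hx.1).sub contDiffAt_const).contMDiffAt.contMDiffWithinAt
  contMDiffOn_invFun := by
    have h1 : ContMDiff (𝓡 3) 𝓘(ℝ, ℝ) ∞ fun y : E3 ↦ (splitLast.symm y).2 + r :=
      ((contDiff_snd.comp splitLast.symm.contDiff).add contDiff_const).contMDiff
    have h2 : ContMDiff (𝓡 3) (𝓡 2) ∞ fun y : E3 ↦ (splitLast.symm y).1 :=
      (contDiff_fst.comp splitLast.symm.contDiff).contMDiff
    refine h1.contMDiffOn.smul ?_
    exact contMDiff_coe_sphere.comp_contMDiffOn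
      ((contMDiffOn_symm_of_mem_maximalAtlas he).comp h2.contMDiffOn fun y hy ↦ hy.1)

/-- Near each point the sphere has a chart with values in an open half-plane. Combined with
`polarCoordinates` it yields coordinates with values in the open half-space, as required of the
charts of a manifold with boundary. -/
lemma exists_sphere_chart (v : S2) {O : Set S2} (hO : IsOpen O) (hv : v ∈ O) :
    ∃ e ∈ IsManifold.maximalAtlas (𝓡 2) ∞ S2, v ∈ e.source ∧ e.source ⊆ O ∧
      ∀ z ∈ e.target, 0 < z 0 := by
  set c := chartAt (EuclideanSpace ℝ (Fin 2)) v
  -- the translation that moves the point into the half-plane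
  let a : EuclideanSpace ℝ (Fin 2) := EuclideanSpace.single 0 1 - c v
  let e₀ := c.trans (Homeomorph.addRight a).toOpenPartialHomeomorph
  have hc : c ∈ IsManifold.maximalAtlas (𝓡 2) ∞ S2 := IsManifold.chart_mem_maximalAtlas v
  have hP : IsOpen {z : EuclideanSpace ℝ (Fin 2) | 0 < z 0} :=
    isOpen_lt continuous_const (by fun_prop)
  have hs : e₀.source = c.source := by simp [e₀]
  have hQ : IsOpen (e₀.source ∩ e₀ ⁻¹' {z | 0 < z 0}) :=
    e₀.continuousOn.isOpen_inter_preimage e₀.open_source hP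
  have he₀ : e₀ ∈ IsManifold.maximalAtlas (𝓡 2) ∞ S2 := by
    refine OpenPartialHomeomorph.mem_maximalAtlas_of_contMDiffOn _ ?_ ?_
    · have h : ContMDiff (𝓡 2) (𝓡 2) ∞ fun z : EuclideanSpace ℝ (Fin 2) ↦ z + a :=
        (contDiff_id.add contDiff_const).contMDiff
      rw [hs]
      exact h.comp_contMDiffOn (contMDiffOn_of_mem_maximalAtlas hc)
    · have h : ContMDiff (𝓡 2) (𝓡 2) ∞ fun z : EuclideanSpace ℝ (Fin 2) ↦ z + -a :=
        (contDiff_id.add contDiff_const).contMDiff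
      exact (contMDiffOn_symm_of_mem_maximalAtlas hc).comp h.contMDiffOn fun y hy ↦ hy.2
  have hO' : IsOpen (O ∩ (e₀.source ∩ e₀ ⁻¹' {z | 0 < z 0})) := hO.inter hQ
  have hsrc : (e₀.restr (O ∩ (e₀.source ∩ e₀ ⁻¹' {z | 0 < z 0}))).source =
      e₀.source ∩ (O ∩ (e₀.source ∩ e₀ ⁻¹' {z | 0 < z 0})) := e₀.restr_source' _ hO'
  refine ⟨e₀.restr (O ∩ (e₀.source ∩ e₀ ⁻¹' {z | 0 < z 0})), ?_, ?_, ?_, ?_⟩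
  · exact restr_mem_maximalAtlas _ he₀ hO'
  · have hv' : v ∈ e₀.source := hs ▸ mem_chart_source _ v
    rw [hsrc]
    refine ⟨hv', hv, hv', ?_⟩
    change 0 < (c v + a) 0
    simp [a]
  · rw [hsrc]
    exact fun x hx ↦ hx.2.1
  · intro z hz
    have h1 := (e₀.restr (O ∩ (e₀.source ∩ e₀ ⁻¹' {z | 0 < z 0}))).map_target hz
    have h2 := (e₀.restr (O ∩ (e₀.source ∩ e₀ ⁻¹' {z | 0 < z 0}))).right_inv hz
    rw [hsrc] at h1
    rw [← h2]
    exact h1.2.2.2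

/-- A map of the sphere which is locally a round sphere in a chart is an immersion. -/
lemma isImmersionAtOfComplement_of_eventuallyEq {N : Type*} [TopologicalSpace N]
    [ChartedSpace (EuclideanHalfSpace 3) N] [IsManifold (𝓡∂ 3) ∞ N] {σ : S2 → N} {v : S2} {r : ℝ}
    (hr : 0 < r) (Φ : PartialDiffeomorph (𝓡 3) (𝓡∂ 3) E3 N ∞) (hv : r • (v : E3) ∈ Φ.source)
    (hσ : ∀ᶠ w in 𝓝 v, σ w = Φ (r • (w : E3))) :
    Manifold.IsImmersionAtOfComplement ℝ (𝓡 2) (𝓡∂ 3) ∞ σ v := by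
  have hO : IsOpen {w : S2 | r • (w : E3) ∈ Φ.source} := Φ.open_source.preimage (by fun_prop)
  obtain ⟨O, hOσ, hOo, hvO⟩ := eventually_nhds_iff.mp (hσ.and (hO.mem_nhds hv))
  obtain ⟨e, he, hve, heO, hpos⟩ := exists_sphere_chart v hOo hvO
  let Ψ := (polarCoordinates v r e he).trans halfSpaceInclusion
  let Θ := Φ.symm.trans Ψ
  have key (w : S2) (hw : w ∈ e.source) : σ w ∈ Θ.source ∧
      (𝓡∂ 3) (Θ (σ w)) = splitLast (e w, 0) := by
    obtain ⟨hσw, hΦ⟩ := hOσ w (heO hw)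
    have hn : ‖r • (w : E3)‖ = r := by simp [norm_smul, hr.le]
    have h0 : r • (w : E3) ≠ 0 := fun h ↦ by rw [h, norm_zero] at hn; exact hr.ne hn
    have h1 : polarCoordinates v r e he (r • (w : E3)) = splitLast (e w, 0) := by
      change splitLast (e (radialProj v (r • (w : E3))), ‖r • (w : E3)‖ - r) = _
      rw [radialProj_smul v w hr, hn, sub_self]
    have h2 : (splitLast (e w, 0) : E3) ∈ halfSpaceInclusion.source := by
      change 0 < splitLast (e w, 0) 0
      rw [splitLast_apply_zero]
      exact hpos _ (e.map_source hw)
    have h3 : r • (w : E3) ∈ (polarCoordinates v r e he).source := by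
      refine ⟨h0, ?_⟩
      rw [Set.mem_preimage, radialProj_smul v w hr]
      exact hw
    have h4 : Φ.symm (σ w) = r • (w : E3) := by
      rw [hσw]
      exact Φ.left_inv hΦ
    have h5 : r • (w : E3) ∈ Ψ.source := ⟨h3, by
      change polarCoordinates v r e he (r • (w : E3)) ∈ halfSpaceInclusion.source
      rw [h1]
      exact h2⟩
    refine ⟨⟨?_, ?_⟩, ?_⟩
    · rw [hσw]
      exact Φ.map_source hΦ
    · change Φ.symm (σ w) ∈ Ψ.source
      rw [h4]
      exact h5
    · change (𝓡∂ 3) ((𝓡∂ 3).symm (polarCoordinates v r e he (Φ.symm (σ w)))) = _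
      rw [h4, h1]
      exact halfSpaceInclusion.left_inv h2
  refine .mk_of_charts splitLast e Θ.toOpenPartialHomeomorph hve (key v hve).1 he ?_
    (fun w hw ↦ (key w hw).1) ?_
  · exact OpenPartialHomeomorph.mem_maximalAtlas_of_contMDiffOn _ Θ.contMDiffOn_toFun
      Θ.contMDiffOn_invFun
  · intro z hz
    have hz' : z ∈ e.target := by simpa using hz
    have := (key _ (e.map_target hz')).2
    rw [e.right_inv hz'] at this
    exact this

end Spheres

/-! ### Pinching one side of a connect sum -/

section Pinch

open Topology

/-- The radial map of `ℝ³` that collapses the closed unit ball to the origin, is injective outside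
it, and is the identity outside the ball of radius `2`. In between, a radius `r` becomes
`2 * r - 2`. -/
noncomputable def collapse (x : E3) : E3 := min (2 - 2 / max ‖x‖ 1) 1 • x

/-- The inverse of `collapse` away from the origin; a radius `r ≤ 2` becomes `r / 2 + 1`. -/
noncomputable def uncollapse (z : E3) : E3 := max (1 / 2 + 1 / ‖z‖) 1 • z

lemma continuous_collapse : Continuous collapse := by
  have : ∀ x : E3, max ‖x‖ 1 ≠ 0 := fun x ↦ (lt_max_of_lt_right one_pos).ne'
  unfold collapse
  fun_prop (disch := exact this _)

lemma collapse_of_norm_le {x : E3} (hx : ‖x‖ ≤ 1) : collapse x = 0 := by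
  simp [collapse, max_eq_right hx]

lemma collapse_of_le_norm {x : E3} (hx : 2 ≤ ‖x‖) : collapse x = x := by
  have h : 2 / ‖x‖ ≤ 1 := (div_le_one (by linarith)).mpr hx
  rw [collapse, max_eq_left (by linarith), min_eq_right (by linarith), one_smul]

lemma norm_collapse {x : E3} (hx : 1 ≤ ‖x‖) (hx' : ‖x‖ ≤ 2) : ‖collapse x‖ = 2 * ‖x‖ - 2 := by
  have h : 1 ≤ 2 / ‖x‖ := (one_le_div (by linarith)).mpr hx'
  have h2 : 2 / ‖x‖ ≤ 2 := (div_le_iff₀ (by linarith)).mpr (by linarith)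
  rw [collapse, max_eq_left hx, min_eq_left (by linarith), norm_smul,
    Real.norm_of_nonneg (by linarith)]
  field_simp

lemma uncollapse_collapse {x : E3} (hx : 1 < ‖x‖) : uncollapse (collapse x) = x := by
  rcases le_total ‖x‖ 2 with h | h
  · have hn := norm_collapse hx.le h
    have h1 : 1 ≤ 2 / ‖x‖ := (one_le_div (by linarith)).mpr h
    have h2 : 2 / ‖x‖ < 2 := (div_lt_iff₀ (by linarith)).mpr (by linarith)
    have h3 : 0 < 2 * ‖x‖ - 2 := by linarith
    have h4 : 1 / 2 ≤ 1 / (2 * ‖x‖ - 2) := one_div_le_one_div_of_le h3 (by linarith)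
    rw [uncollapse, hn, max_eq_left (by linarith), collapse, max_eq_left hx.le,
      min_eq_left (by linarith), smul_smul]
    convert one_smul ℝ x using 2
    have h5 : ‖x‖ ≠ 0 := by linarith
    have h6 : ‖x‖ - 1 ≠ 0 := by linarith
    have h7 : 2 * ‖x‖ - 2 ≠ 0 := h3.ne'
    field_simp
    ring
  · have h4 : 1 / ‖x‖ ≤ 1 / 2 := one_div_le_one_div_of_le (by norm_num) h
    rw [collapse_of_le_norm h, uncollapse, max_eq_right (by linarith), one_smul]

lemma norm_uncollapse {z : E3} (hz : z ≠ 0) : ‖uncollapse z‖ = max (‖z‖ / 2 + 1) ‖z‖ := by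
  have hz' : 0 < ‖z‖ := norm_pos_iff.mpr hz
  rw [uncollapse, norm_smul, Real.norm_of_nonneg (by positivity), max_mul_of_nonneg _ _ hz'.le,
    one_mul]
  congr 1
  field_simp

lemma one_lt_norm_uncollapse {z : E3} (hz : z ≠ 0) : 1 < ‖uncollapse z‖ := by
  have hz' : 0 < ‖z‖ := norm_pos_iff.mpr hz
  rw [norm_uncollapse hz]
  exact lt_max_of_lt_left (by linarith)

lemma collapse_uncollapse {z : E3} (hz : z ≠ 0) : collapse (uncollapse z) = z := by
  have hz' : 0 < ‖z‖ := norm_pos_iff.mpr hz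
  have hn := norm_uncollapse hz
  rcases le_total ‖z‖ 2 with h | h
  · have h1 : 1 / 2 ≤ 1 / ‖z‖ := one_div_le_one_div_of_le hz' h
    rw [max_eq_left (by linarith)] at hn
    have h2 : 1 ≤ 2 / (‖z‖ / 2 + 1) := (one_le_div (by linarith)).mpr (by linarith)
    rw [collapse, hn, max_eq_left (by linarith), min_eq_left (by linarith), uncollapse,
      max_eq_left (by linarith), smul_smul]
    convert one_smul ℝ z using 2
    have : ‖z‖ / 2 + 1 ≠ 0 := by linarith
    field_simp
    ring
  · rw [max_eq_right (by linarith)] at hn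
    have h1 : 1 / ‖z‖ ≤ 1 / 2 := one_div_le_one_div_of_le (by norm_num) h
    have : uncollapse z = z := by rw [uncollapse, max_eq_right (by linarith), one_smul]
    rw [this, collapse_of_le_norm h]

lemma collapse_eq_iff {x z : E3} (hz : z ≠ 0) : collapse x = z ↔ x = uncollapse z := by
  constructor
  · rintro rfl
    rcases le_or_gt ‖x‖ 1 with h | h
    · exact (hz (collapse_of_norm_le h)).elim
    · exact (uncollapse_collapse h).symm
  · rintro rfl
    exact collapse_uncollapse hz

lemma collapse_eq_zero_iff {x : E3} : collapse x = 0 ↔ ‖x‖ ≤ 1 := by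
  refine ⟨fun h ↦ ?_, collapse_of_norm_le⟩
  by_contra! hx
  have := uncollapse_collapse hx
  rw [h] at this
  simp only [uncollapse, smul_zero] at this
  rw [← this, norm_zero] at hx
  linarith

/-- One side of a connect sum decomposition of `M`: the complement in `Y` of the open unit ball of
a chart `ball` is embedded in `M` as a closed set, the closed set `other` covers the rest of `M`,
and the two meet in the image of the unit sphere. -/
structure ConnectSumSide (Y M : Type*) [TopologicalSpace Y] [TopologicalSpace M] where
  /-- the chart whose open unit ball is removed -/
  ball : E3 → Y
  isOpenEmbedding : IsOpenEmbedding ball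
  /-- the inclusion of the complement of the open ball -/
  incl : Y → M
  /-- the inverse of `incl` -/
  ret : M → Y
  ret_incl : Set.LeftInvOn ret incl (ball '' Metric.ball 0 1)ᶜ
  continuousOn_incl : ContinuousOn incl (ball '' Metric.ball 0 1)ᶜ
  continuousOn_ret : ContinuousOn ret (incl '' (ball '' Metric.ball 0 1)ᶜ)
  /-- the other side -/
  other : Set M
  isClosed_image : IsClosed (incl '' (ball '' Metric.ball 0 1)ᶜ)
  isClosed_other : IsClosed other
  cover : incl '' (ball '' Metric.ball 0 1)ᶜ ∪ other = Set.univ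
  inter : ∀ y ∈ (ball '' Metric.ball 0 1)ᶜ, incl y ∈ other ↔ y ∈ ball '' Metric.sphere 0 1

namespace ConnectSumSide

variable {Y M : Type*} [TopologicalSpace Y] [TopologicalSpace M] (S : ConnectSumSide Y M)

/-- The part of `M` that comes from `Y`. -/
def image : Set M := S.incl '' (S.ball '' Metric.ball 0 1)ᶜ

lemma ball_mem_compl {x : E3} (hx : 1 ≤ ‖x‖) : S.ball x ∈ (S.ball '' Metric.ball 0 1)ᶜ := by
  rintro ⟨z, hz, h⟩
  rw [S.isOpenEmbedding.injective h, mem_ball_zero_iff] at hz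
  linarith

lemma incl_ball_mem_image {x : E3} (hx : 1 ≤ ‖x‖) : S.incl (S.ball x) ∈ S.image :=
  ⟨_, S.ball_mem_compl hx, rfl⟩

open Classical in
/-- The self-map of `Y` given by `collapse` in the chart and by the identity outside it. -/
noncomputable def squash (y : Y) : Y :=
  if h : ∃ x, S.ball x = y then S.ball (collapse h.choose) else y

lemma squash_ball (x : E3) : S.squash (S.ball x) = S.ball (collapse x) := by
  have h : ∃ z, S.ball z = S.ball x := ⟨x, rfl⟩
  rw [squash, dif_pos h, S.isOpenEmbedding.injective h.choose_spec]

lemma squash_of_notMem {y : Y} (h : y ∉ Set.range S.ball) : S.squash y = y := dif_neg h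

lemma continuous_squash [T2Space Y] : Continuous S.squash := by
  have hK : IsClosed (S.ball '' Metric.closedBall 0 2) :=
    ((isCompact_closedBall 0 2).image S.isOpenEmbedding.continuous).isClosed
  refine continuous_iff_continuousAt.mpr fun y ↦ ?_
  by_cases hy : y ∈ Set.range S.ball
  · obtain ⟨x, rfl⟩ := hy
    rw [← S.isOpenEmbedding.continuousAt_iff]
    have : S.squash ∘ S.ball = S.ball ∘ collapse := funext S.squash_ball
    rw [this]
    exact (S.isOpenEmbedding.continuous.comp continuous_collapse).continuousAt
  · refine continuousAt_id.congr ?_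
    have : y ∈ (S.ball '' Metric.closedBall 0 2)ᶜ := fun ⟨x, _, h⟩ ↦ hy ⟨x, h⟩
    filter_upwards [hK.isOpen_compl.mem_nhds this] with z hz
    by_cases hz' : z ∈ Set.range S.ball
    · obtain ⟨x, rfl⟩ := hz'
      rw [S.squash_ball, collapse_of_le_norm]
      · rfl
      · by_contra! h
        exact hz ⟨x, by simpa using h.le, rfl⟩
    · exact (S.squash_of_notMem hz').symm

open Classical in
/-- The pinch map, which collapses the other side of the connect sum to a point. -/
noncomputable def pinch (m : M) : Y :=
  if m ∈ S.other then S.ball 0 else S.squash (S.ret m)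

lemma pinch_of_mem_other {m : M} (h : m ∈ S.other) : S.pinch m = S.ball 0 := if_pos h

lemma pinch_incl {y : Y} (hy : y ∈ (S.ball '' Metric.ball 0 1)ᶜ) :
    S.pinch (S.incl y) = S.squash y := by
  by_cases h : S.incl y ∈ S.other
  · obtain ⟨x, hx, rfl⟩ := (S.inter y hy).mp h
    rw [S.pinch_of_mem_other h, S.squash_ball, collapse_of_norm_le (by simpa using hx.le)]
  · rw [pinch, if_neg h, S.ret_incl hy]

lemma pinch_incl_ball {x : E3} (hx : 1 ≤ ‖x‖) :
    S.pinch (S.incl (S.ball x)) = S.ball (collapse x) := by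
  rw [S.pinch_incl (S.ball_mem_compl hx), S.squash_ball]

lemma continuous_pinch [T2Space Y] : Continuous S.pinch := by
  rw [← continuousOn_univ, ← S.cover]
  refine ContinuousOn.union_of_isClosed ?_ ?_ S.isClosed_image S.isClosed_other
  · refine (S.continuous_squash.comp_continuousOn S.continuousOn_ret).congr ?_
    rintro _ ⟨y, hy, rfl⟩
    rw [S.pinch_incl hy, Function.comp_apply, S.ret_incl hy]
  · exact continuousOn_const.congr fun m hm ↦ S.pinch_of_mem_other hm

/-- Away from the centre of the ball, the pinch map is injective over the chart. -/
lemma pinch_eq_ball_iff {m : M} {z : E3} (hz : z ≠ 0) :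
    S.pinch m = S.ball z ↔ m = S.incl (S.ball (uncollapse z)) := by
  constructor
  · intro h
    have hm : m ∈ S.incl '' (S.ball '' Metric.ball 0 1)ᶜ ∪ S.other := S.cover ▸ Set.mem_univ m
    rcases hm with ⟨y, hy, rfl⟩ | hm
    · rw [S.pinch_incl hy] at h
      by_cases hr : y ∈ Set.range S.ball
      · obtain ⟨x, rfl⟩ := hr
        rw [S.squash_ball] at h
        rw [(collapse_eq_iff hz).mp (S.isOpenEmbedding.injective h)]
      · rw [S.squash_of_notMem hr] at h
        exact (hr ⟨z, h.symm⟩).elim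
    · rw [S.pinch_of_mem_other hm] at h
      exact (hz (S.isOpenEmbedding.injective h).symm).elim
  · rintro rfl
    rw [S.pinch_incl_ball (one_lt_norm_uncollapse hz).le, collapse_uncollapse hz]

lemma pinch_eq_ball_zero_iff {m : M} : S.pinch m = S.ball 0 ↔ m ∈ S.other := by
  refine ⟨fun h ↦ ?_, S.pinch_of_mem_other⟩
  have hm : m ∈ S.incl '' (S.ball '' Metric.ball 0 1)ᶜ ∪ S.other := S.cover ▸ Set.mem_univ m
  rcases hm with ⟨y, hy, rfl⟩ | hm
  · rw [S.pinch_incl hy] at h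
    by_cases hr : y ∈ Set.range S.ball
    · obtain ⟨x, rfl⟩ := hr
      rw [S.squash_ball] at h
      have hx := collapse_eq_zero_iff.mp (S.isOpenEmbedding.injective h)
      rw [S.inter _ hy]
      refine ⟨x, ?_, rfl⟩
      rw [mem_sphere_zero_iff_norm]
      refine le_antisymm hx ?_
      by_contra! hlt
      exact hy ⟨x, by simpa using hlt, rfl⟩
    · rw [S.squash_of_notMem hr] at h
      exact (hr ⟨0, h.symm⟩).elim
  · exact hm

/-- The fibres of the pinch map on the closed piece coming from `Y` are points, and a sphere over
the centre of the ball. -/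
lemma isConnected_fiber_pinch (y : Y) : IsConnected {m ∈ S.image | S.pinch m = y} := by
  by_cases hy : y ∈ Set.range S.ball
  · obtain ⟨z, rfl⟩ := hy
    by_cases hz : z = 0
    · subst hz
      have : {m ∈ S.image | S.pinch m = S.ball 0} =
          S.incl '' (S.ball '' Metric.sphere 0 1) := by
        ext m
        simp only [Set.mem_ofPred_eq, S.pinch_eq_ball_zero_iff]
        constructor
        · rintro ⟨⟨y, hy, rfl⟩, h⟩
          exact ⟨y, (S.inter y hy).mp h, rfl⟩
        · rintro ⟨_, ⟨x, hx, rfl⟩, rfl⟩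
          have hx1 : 1 ≤ ‖x‖ := (mem_sphere_zero_iff_norm.mp hx).ge
          exact ⟨S.incl_ball_mem_image hx1, (S.inter _ (S.ball_mem_compl hx1)).mpr ⟨x, hx, rfl⟩⟩
      rw [this]
      have hs : IsConnected (Metric.sphere (0 : E3) 1) :=
        isConnected_sphere (by rw [← Module.finrank_eq_rank]; simp) 0 zero_le_one
      refine (hs.image _ S.isOpenEmbedding.continuous.continuousOn).image _
        (S.continuousOn_incl.mono ?_)
      rintro _ ⟨x, hx, rfl⟩
      exact S.ball_mem_compl (mem_sphere_zero_iff_norm.mp hx).ge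
    · have : {m ∈ S.image | S.pinch m = S.ball z} = {S.incl (S.ball (uncollapse z))} := by
        ext m
        simp only [Set.mem_ofPred_eq, S.pinch_eq_ball_iff hz, Set.mem_singleton_iff]
        refine ⟨And.right, ?_⟩
        rintro rfl
        exact ⟨S.incl_ball_mem_image (one_lt_norm_uncollapse hz).le, rfl⟩
      rw [this]
      exact isConnected_singleton
  · have hy' : y ∈ (S.ball '' Metric.ball 0 1)ᶜ := fun ⟨x, _, h⟩ ↦ hy ⟨x, h⟩
    have : {m ∈ S.image | S.pinch m = y} = {S.incl y} := by
      ext m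
      simp only [Set.mem_ofPred_eq, Set.mem_singleton_iff]
      constructor
      · rintro ⟨⟨w, hw, rfl⟩, h⟩
        rw [S.pinch_incl hw] at h
        by_cases hr : w ∈ Set.range S.ball
        · obtain ⟨x, rfl⟩ := hr
          rw [S.squash_ball] at h
          exact (hy ⟨_, h⟩).elim
        · rw [S.squash_of_notMem hr] at h
          rw [h]
      · rintro rfl
        exact ⟨⟨y, hy', rfl⟩, by rw [S.pinch_incl hy', S.squash_of_notMem hy]⟩
    rw [this]
    exact isConnected_singleton

lemma surjective_pinch : Function.Surjective S.pinch := fun y ↦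
  let ⟨m, _, hm⟩ := (S.isConnected_fiber_pinch y).nonempty
  ⟨m, hm⟩

end ConnectSumSide

end Pinch

/-! ### The two sides of a connect sum decomposition -/

namespace ConnectSumDecomposition

open Topology

variable {A B M : Type u}
    [TopologicalSpace A] [ChartedSpace (EuclideanHalfSpace 3) A]
    [TopologicalSpace B] [ChartedSpace (EuclideanHalfSpace 3) B]
    [TopologicalSpace M] [ChartedSpace (EuclideanHalfSpace 3) M] (D : ConnectSumDecomposition A B M)

/-- The side of `A`. The inverse `ret` is a choice, which matters only on the image of the side. -/
noncomputable def sideA : ConnectSumSide A M where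
  ball := D.ballA
  isOpenEmbedding := D.isBallChart_ballA.isOpenEmbedding
  incl := D.inclA
  ret := D.isDiffeoOnImage_inclA.2.choose
  ret_incl := D.isDiffeoOnImage_inclA.2.choose_spec.1
  continuousOn_incl := D.isDiffeoOnImage_inclA.1.continuousOn
  continuousOn_ret := D.isDiffeoOnImage_inclA.2.choose_spec.2.continuousOn
  other := D.inclB '' (D.ballB '' Metric.ball 0 1)ᶜ
  isClosed_image := D.isClosed_imageA
  isClosed_other := D.isClosed_imageB
  cover := D.cover
  inter y hy := by
    constructor
    · rintro ⟨b, hb, h⟩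
      obtain ⟨x, rfl, -⟩ := (D.glue y hy b hb).mp h.symm
      exact ⟨x, x.2, rfl⟩
    · rintro ⟨x, hx, rfl⟩
      refine ⟨D.ballB (D.φ ⟨x, hx⟩), ?_, ?_⟩
      · rintro ⟨z, hz, h⟩
        rw [D.isBallChart_ballB.isOpenEmbedding.injective h, mem_ball_zero_iff] at hz
        simp at hz
      · refine ((D.glue _ hy _ ?_).mpr ⟨⟨x, hx⟩, rfl, rfl⟩).symm
        rintro ⟨z, hz, h⟩
        rw [D.isBallChart_ballB.isOpenEmbedding.injective h, mem_ball_zero_iff] at hz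
        simp at hz

/-- The side of `B`. -/
noncomputable def sideB : ConnectSumSide B M where
  ball := D.ballB
  isOpenEmbedding := D.isBallChart_ballB.isOpenEmbedding
  incl := D.inclB
  ret := D.isDiffeoOnImage_inclB.2.choose
  ret_incl := D.isDiffeoOnImage_inclB.2.choose_spec.1
  continuousOn_incl := D.isDiffeoOnImage_inclB.1.continuousOn
  continuousOn_ret := D.isDiffeoOnImage_inclB.2.choose_spec.2.continuousOn
  other := D.inclA '' (D.ballA '' Metric.ball 0 1)ᶜ
  isClosed_image := D.isClosed_imageB
  isClosed_other := D.isClosed_imageA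
  cover := by rw [Set.union_comm]; exact D.cover
  inter y hy := by
    constructor
    · rintro ⟨a, ha, h⟩
      obtain ⟨x, -, rfl⟩ := (D.glue a ha y hy).mp h
      exact ⟨D.φ x, (D.φ x).2, rfl⟩
    · rintro ⟨x, hx, rfl⟩
      have hmem : D.ballA (D.φ.symm ⟨x, hx⟩) ∈ (D.ballA '' Metric.ball 0 1)ᶜ := by
        rintro ⟨z, hz, h⟩
        rw [D.isBallChart_ballA.isOpenEmbedding.injective h, mem_ball_zero_iff] at hz
        simp at hz
      exact ⟨_, hmem, (D.glue _ hmem _ hy).mpr ⟨D.φ.symm ⟨x, hx⟩, rfl, by simp⟩⟩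

/-- In the chart `ballA`, the inclusion of the side of `A` is a local diffeomorphism outside the
closed unit ball. -/
lemma isLocalDiffeomorphAt_inclA_ballA [T2Space A] {x : E3} (hx : 1 < ‖x‖) :
    IsLocalDiffeomorphAt (𝓡 3) (𝓡∂ 3) ∞ (D.inclA ∘ D.ballA) x := by
  have hK : IsClosed (D.ballA '' Metric.closedBall 0 1) :=
    ((isCompact_closedBall 0 1).image D.isBallChart_ballA.isOpenEmbedding.continuous).isClosed
  have hsub : (D.ballA '' Metric.closedBall 0 1)ᶜ ⊆ (D.ballA '' Metric.ball 0 1)ᶜ :=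
    Set.compl_subset_compl.mpr (Set.image_mono Metric.ball_subset_closedBall)
  have hsub' : D.sideA.otherᶜ ⊆ D.inclA '' (D.ballA '' Metric.ball 0 1)ᶜ := fun m hm ↦
    (show m ∈ D.inclA '' _ ∪ _ from D.cover ▸ Set.mem_univ m).resolve_right hm
  have hg := D.isDiffeoOnImage_inclA.2.choose_spec
  have hinter (y) (hy : y ∈ (D.ballA '' Metric.ball 0 1)ᶜ) :
      D.inclA y ∈ D.sideA.other ↔ y ∈ D.ballA '' Metric.sphere 0 1 := D.sideA.inter y hy
  let Φ : PartialDiffeomorph (𝓡∂ 3) (𝓡∂ 3) A M ∞ := {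
    toFun := D.inclA
    invFun := D.isDiffeoOnImage_inclA.2.choose
    source := (D.ballA '' Metric.closedBall 0 1)ᶜ
    target := D.sideA.otherᶜ
    map_source' y hy h :=
      hy (Set.image_mono Metric.sphere_subset_closedBall ((hinter y (hsub hy)).mp h))
    map_target' m hm := by
      obtain ⟨y, hy, rfl⟩ := hsub' hm
      rw [hg.1 hy]
      rintro ⟨z, hz, rfl⟩
      refine hm ((hinter _ hy).mpr ⟨z, ?_, rfl⟩)
      rw [mem_closedBall_zero_iff] at hz
      rw [mem_sphere_zero_iff_norm]
      refine le_antisymm hz ?_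
      by_contra! h
      exact hy ⟨z, by simpa using h, rfl⟩
    left_inv' y hy := hg.1 (hsub hy)
    right_inv' m hm := by
      obtain ⟨y, hy, rfl⟩ := hsub' hm
      rw [hg.1 hy]
    open_source := hK.isOpen_compl
    open_target := D.sideA.isClosed_other.isOpen_compl
    contMDiffOn_toFun := D.isDiffeoOnImage_inclA.1.mono hsub
    contMDiffOn_invFun := hg.2.mono hsub' }
  refine (D.isBallChart_ballA.isLocalDiffeomorph x).comp (K := 𝓡∂ 3) (P := M)
    ⟨Φ, ?_, fun _ _ ↦ rfl⟩
  rintro ⟨z, hz, h⟩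
  rw [D.isBallChart_ballA.isOpenEmbedding.injective h, mem_closedBall_zero_iff] at hz
  linarith

end ConnectSumDecomposition

/-! ### Lifts of round spheres to covering spaces -/

section LiftedSphere

open Topology

/-- A lift to a covering space of a round sphere in a chart is an embedded sphere. -/
lemma isEmbeddedSphere_of_lift {M N : Type*} [TopologicalSpace M]
    [ChartedSpace (EuclideanHalfSpace 3) M] [TopologicalSpace N] [T2Space N]
    [ChartedSpace (EuclideanHalfSpace 3) N] [IsManifold (𝓡∂ 3) ∞ N] [IsManifold (𝓡∂ 3) ∞ M]
    {p : N → M}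
    (hp : IsLocalDiffeomorph (𝓡∂ 3) (𝓡∂ 3) ∞ p) {j : E3 → M} {r : ℝ} (hr : 0 < r)
    (hj : ∀ v : S2, IsLocalDiffeomorphAt (𝓡 3) (𝓡∂ 3) ∞ j (r • (v : E3))) {σ : S2 → N}
    (hσ : Continuous σ) (hinj : Function.Injective σ) (hpσ : ∀ v, p (σ v) = j (r • (v : E3))) :
    IsEmbeddedSphere σ := by
  have key (v : S2) : ∃ Φ : PartialDiffeomorph (𝓡 3) (𝓡∂ 3) E3 N ∞, r • (v : E3) ∈ Φ.source ∧
      ∀ᶠ w in 𝓝 v, σ w = Φ (r • (w : E3)) := by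
    obtain ⟨Ψ, hΨ, hΨj⟩ := hj v
    obtain ⟨Θ, hΘ, hΘp⟩ := hp (σ v)
    refine ⟨Ψ.trans Θ.symm, ⟨hΨ, ?_⟩, ?_⟩
    · change Ψ (r • (v : E3)) ∈ Θ.target
      rw [← hΨj hΨ, ← hpσ, hΘp hΘ]
      exact Θ.map_source hΘ
    · have h1 : ∀ᶠ w : S2 in 𝓝 v, r • (w : E3) ∈ Ψ.source :=
        (Continuous.continuousAt (by fun_prop)).eventually_mem (Ψ.open_source.mem_nhds hΨ)
      have h2 : ∀ᶠ w : S2 in 𝓝 v, σ w ∈ Θ.source :=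
        hσ.continuousAt.eventually_mem (Θ.open_source.mem_nhds hΘ)
      filter_upwards [h1, h2] with w hw1 hw2
      change σ w = Θ.symm (Ψ (r • (w : E3)))
      rw [← hΨj hw1, ← hpσ, hΘp hw2]
      exact (Θ.left_inv hw2).symm
  refine ⟨⟨?_, (hσ.isClosedEmbedding hinj).isEmbedding⟩, fun v ↦ ?_⟩
  -- the complement in the definition of an immersion is the radial direction
  · refine ⟨ℝ, inferInstance, inferInstance, fun v ↦ ?_⟩
    obtain ⟨Φ, hv, hΦ⟩ := key v
    exact isImmersionAtOfComplement_of_eventuallyEq hr Φ hv hΦ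
  · obtain ⟨Φ, hv, hΦ⟩ := key v
    rw [hΦ.self_of_nhds]
    have := (Φ.isLocalDiffeomorphAt _ _ _ hv)
    refine (this.isInteriorPoint_iff (by simp)).mp ?_
    exact BoundarylessManifold.isInteriorPoint

end LiftedSphere

/-! ### Two independent circle maps -/

section IndependentCircleMaps

open unitInterval Topology

/-- The real representative in `(-1/2, 1/2]` of a point of the circle. -/
noncomputable def circleBranch (x : UnitAddCircle) : ℝ :=
  (AddCircle.equivIoc (1 : ℝ) (-1 / 2) x : ℝ)

lemma coe_circleBranch (x : UnitAddCircle) : (circleBranch x : UnitAddCircle) = x :=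
  (AddCircle.equivIoc (1 : ℝ) (-1 / 2)).symm_apply_apply x

lemma continuousAt_circleBranch {x : UnitAddCircle} (hx : x ≠ ((1 / 2 : ℝ) : UnitAddCircle)) :
    ContinuousAt circleBranch x := by
  have h : ((-1 / 2 : ℝ) : UnitAddCircle) = ((1 / 2 : ℝ) : UnitAddCircle) :=
    unitAddCircle_coe_eq_coe.mpr ⟨-1, by norm_num⟩
  exact continuousAt_subtype_val.comp (AddCircle.continuousAt_equivIoc (1 : ℝ) (-1 / 2) (h ▸ hx))

variable {X : Type*} [TopologicalSpace X]

/-- Along a path on which a circle map avoids the value `1/2`, its cocycle is the difference of the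
values of a fixed real function. -/
lemma circleCochain_of_ne_half (u : C(X, UnitAddCircle)) (γ : C(I, X))
    (h : ∀ t, u (γ t) ≠ ((1 / 2 : ℝ) : UnitAddCircle)) :
    circleCochain u γ = circleBranch (u (γ 1)) - circleBranch (u (γ 0)) :=
  circleCochain_eq u γ (F := fun t ↦ circleBranch (u (γ t)))
    (continuous_iff_continuousAt.mpr fun t ↦ ContinuousAt.comp (f := fun t ↦ u (γ t))
      (continuousAt_circleBranch (h t)) (Continuous.continuousAt (by fun_prop)))
    fun t ↦ coe_circleBranch _

/-- Every point at which `u` has the value `1/2` lies on a path that crosses the level `1/2` of `u`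
once and is disjoint from the level `1/2` of `v`. The crossing is normalized: along the path, `u` is
the parameter and `v` vanishes. -/
def HasTransversals (u v : C(X, UnitAddCircle)) : Prop :=
  ∀ x, u x = ((1 / 2 : ℝ) : UnitAddCircle) → ∃ δ : C(I, X), (∃ t, δ t = x) ∧
    (∀ t, u (δ t) = ((t : ℝ) : UnitAddCircle)) ∧ ∀ t, v (δ t) = 0

lemma zero_ne_half : (0 : UnitAddCircle) ≠ ((1 / 2 : ℝ) : UnitAddCircle) := by
  rw [← AddCircle.coe_zero, Ne, unitAddCircle_coe_eq_coe]
  rintro ⟨n, hn⟩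
  have h1 : (-1 : ℝ) < n := by rw [← hn]; norm_num
  have h2 : (n : ℝ) < 0 := by rw [← hn]; norm_num
  have h1 : -1 < n := by exact_mod_cast h1
  have h2 : n < 0 := by exact_mod_cast h2
  omega

/-- Two circle maps whose levels `1/2` do not jointly separate `X`, but can each be crossed by a
path that is disjoint from the other, have independent cohomology classes. -/
lemma two_le_bettiOne_of_circleMaps {X : Type u} [TopologicalSpace X] [PathConnectedSpace X]
    (u v : C(X, UnitAddCircle)) (hu : ∃ x, u x = ((1 / 2 : ℝ) : UnitAddCircle))
    (hv : ∃ x, v x = ((1 / 2 : ℝ) : UnitAddCircle)) (huv : HasTransversals u v)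
    (hvu : HasTransversals v u)
    (hO : IsPathConnected {x | u x ≠ ((1 / 2 : ℝ) : UnitAddCircle) ∧
      v x ≠ ((1 / 2 : ℝ) : UnitAddCircle)}) : 2 ≤ bettiOne X := by
  refine two_le_bettiOne _ _ (isPathCocycle_circleCochain u) (isPathCocycle_circleCochain v) ?_
  rintro α β ⟨h, hh⟩
  -- a primitive `h` of the combination is determined off the two levels
  have main (x y : X)
      (hx : u x ≠ ((1 / 2 : ℝ) : UnitAddCircle) ∧ v x ≠ ((1 / 2 : ℝ) : UnitAddCircle))
      (hy : u y ≠ ((1 / 2 : ℝ) : UnitAddCircle) ∧ v y ≠ ((1 / 2 : ℝ) : UnitAddCircle)) :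
      h y - h x = α * (circleBranch (u y) - circleBranch (u x)) +
        β * (circleBranch (v y) - circleBranch (v x)) := by
    obtain ⟨γ, hγ⟩ := hO.joinedIn x hx y hy
    have := hh γ.toContinuousMap
    rw [circleCochain_of_ne_half u _ fun t ↦ (hγ t).1,
      circleCochain_of_ne_half v _ fun t ↦ (hγ t).2] at this
    simpa using this.symm
  -- along a path across the level of `u` the cocycle of `u` is `1`, while `h` does not change
  have cross (u v : C(X, UnitAddCircle)) (α β : ℝ)
      (hu : ∃ x, u x = ((1 / 2 : ℝ) : UnitAddCircle)) (huv : HasTransversals u v)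
      (hh : ∀ γ, α * circleCochain u γ + β * circleCochain v γ = h (γ 1) - h (γ 0))
      (main : ∀ x y, u x ≠ ((1 / 2 : ℝ) : UnitAddCircle) ∧ v x ≠ ((1 / 2 : ℝ) : UnitAddCircle) →
        u y ≠ ((1 / 2 : ℝ) : UnitAddCircle) ∧ v y ≠ ((1 / 2 : ℝ) : UnitAddCircle) →
        h y - h x = α * (circleBranch (u y) - circleBranch (u x)) +
        β * (circleBranch (v y) - circleBranch (v x))) : α = 0 := by
    obtain ⟨x, hx⟩ := hu
    obtain ⟨δ, -, hδu, hδv⟩ := huv x hx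
    have h0 : u (δ 0) = 0 := by rw [hδu]; simp
    have h1 : u (δ 1) = 0 := by
      rw [hδu, ← AddCircle.coe_zero, unitAddCircle_coe_eq_coe]
      exact ⟨1, by simp⟩
    have e := main (δ 0) (δ 1) ⟨h0 ▸ zero_ne_half, hδv 0 ▸ zero_ne_half⟩
      ⟨h1 ▸ zero_ne_half, hδv 1 ▸ zero_ne_half⟩
    have e' := hh δ
    rw [circleCochain_eq u δ (F := fun t : I ↦ (t : ℝ)) (by fun_prop) fun t ↦ (hδu t).symm,
      circleCochain_eq v δ (F := fun _ ↦ (0 : ℝ)) (by fun_prop) fun t ↦ by simp [hδv], e, h0, h1,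
      hδv, hδv] at e'
    simpa using e'
  refine ⟨cross u v α β hu huv hh main, cross v u β α hv hvu (fun γ ↦ ?_) fun x y hx hy ↦ ?_⟩
  · rw [← hh γ]; ring
  · rw [main x y hx.symm hy.symm]; ring

/-- If the two levels `1/2` do not jointly separate `X`, then neither does a single one of them. -/
lemma isPreconnected_ne_half {u v : C(X, UnitAddCircle)} (hvu : HasTransversals v u)
    (hO : IsConnected {x | u x ≠ ((1 / 2 : ℝ) : UnitAddCircle) ∧
      v x ≠ ((1 / 2 : ℝ) : UnitAddCircle)}) :
    IsPreconnected {x | u x ≠ ((1 / 2 : ℝ) : UnitAddCircle)} := by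
  obtain ⟨x₀, hx₀⟩ := hO.nonempty
  refine isPreconnected_of_forall x₀ fun y hy ↦ ?_
  by_cases h : v y = ((1 / 2 : ℝ) : UnitAddCircle)
  · obtain ⟨δ, ⟨t, rfl⟩, hδv, hδu⟩ := hvu y h
    refine ⟨{x | u x ≠ ((1 / 2 : ℝ) : UnitAddCircle) ∧
      v x ≠ ((1 / 2 : ℝ) : UnitAddCircle)} ∪ Set.range δ, ?_, .inl hx₀, .inr ⟨t, rfl⟩, ?_⟩
    · rintro x (hx | ⟨s, rfl⟩)
      · exact hx.1
      · rw [Set.mem_ofPred_eq, hδu]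
        exact zero_ne_half
    · refine hO.isPreconnected.union (δ 0) ⟨hδu 0 ▸ zero_ne_half, ?_⟩ ⟨0, rfl⟩
        (isPreconnected_range δ.continuous)
      rw [hδv]
      simpa using zero_ne_half
  · exact ⟨_, fun x hx ↦ hx.1, hx₀, ⟨hy, h⟩, hO.isPreconnected⟩

lemma preconnectedSpace_of_ne_half {u v : C(X, UnitAddCircle)} (huv : HasTransversals u v)
    (hvu : HasTransversals v u)
    (hO : IsConnected {x | u x ≠ ((1 / 2 : ℝ) : UnitAddCircle) ∧
      v x ≠ ((1 / 2 : ℝ) : UnitAddCircle)}) : PreconnectedSpace X := by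
  have hu := isPreconnected_ne_half hvu hO
  obtain ⟨x₀, hx₀, hx₀'⟩ := hO.nonempty
  refine ⟨isPreconnected_of_forall x₀ fun y _ ↦ ?_⟩
  by_cases h : u y = ((1 / 2 : ℝ) : UnitAddCircle)
  · obtain ⟨δ, ⟨t, rfl⟩, hδu, -⟩ := huv y h
    refine ⟨{x | u x ≠ ((1 / 2 : ℝ) : UnitAddCircle)} ∪ Set.range δ, Set.subset_univ _, .inl hx₀,
      .inr ⟨t, rfl⟩, hu.union (δ 0) ?_ ⟨0, rfl⟩ (isPreconnected_range δ.continuous)⟩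
    rw [Set.mem_ofPred_eq, hδu]
    simpa using zero_ne_half
  · exact ⟨_, Set.subset_univ _, hx₀, h, hu⟩

end IndependentCircleMaps

/-! ### Open balls embedded in a space -/

section EmbeddedBalls

open Topology

variable {Z : Type*} {L : E3 → Z}

open Classical in
/-- The circle map supported in an embedded ball that wraps each ray from the centre, up to radius
`2`, once around the circle. The level `1/2` is the sphere of radius `1`. -/
noncomputable def collarMap (L : E3 → Z) (y : Z) : UnitAddCircle :=
  if h : ∃ z, L z = y then ((min (‖h.choose‖ / 2) 1 : ℝ) : UnitAddCircle) else 0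

lemma collarMap_apply (hL : Function.Injective L) (z : E3) :
    collarMap L (L z) = ((min (‖z‖ / 2) 1 : ℝ) : UnitAddCircle) := by
  have h : ∃ x, L x = L z := ⟨z, rfl⟩
  rw [collarMap, dif_pos h, hL h.choose_spec]

lemma collarMap_of_notMem {y : Z} (hy : y ∉ Set.range L) : collarMap L y = 0 := dif_neg hy

lemma collarMap_apply_zero (hL : Function.Injective L) : collarMap L (L 0) = 0 := by
  rw [collarMap_apply hL]
  simp

lemma coe_one_unitAddCircle : ((1 : ℝ) : UnitAddCircle) = 0 := by
  rw [← AddCircle.coe_zero, unitAddCircle_coe_eq_coe]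
  exact ⟨1, by simp⟩

lemma collarMap_eq_half_iff (hL : Function.Injective L) {y : Z} :
    collarMap L y = ((1 / 2 : ℝ) : UnitAddCircle) ↔ ∃ z, ‖z‖ = 1 ∧ L z = y := by
  by_cases hy : y ∈ Set.range L
  · obtain ⟨x, rfl⟩ := hy
    rw [collarMap_apply hL, unitAddCircle_coe_eq_coe]
    constructor
    · rintro ⟨n, hn⟩
      refine ⟨x, ?_, rfl⟩
      have h0 : 0 ≤ min (‖x‖ / 2) 1 := le_min (by positivity) zero_le_one
      have h1 : min (‖x‖ / 2) 1 ≤ 1 := min_le_right _ _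
      have h2 : (-1 : ℝ) < n := by rw [← hn]; linarith
      have h3 : (n : ℝ) < 1 := by rw [← hn]; linarith
      have h2 : -1 < n := by exact_mod_cast h2
      have h3 : n < 1 := by exact_mod_cast h3
      obtain rfl : n = 0 := by omega
      rcases min_cases (‖x‖ / 2) 1 with h | h
      · rw [h.1] at hn
        push_cast at hn
        linarith
      · rw [h.1] at hn
        norm_num at hn
    · rintro ⟨z, hz, h⟩
      rw [← hL h, hz]
      exact ⟨0, by norm_num⟩
  · rw [collarMap_of_notMem hy]
    refine ⟨fun h ↦ (zero_ne_half h).elim, ?_⟩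
    rintro ⟨z, -, h⟩
    exact (hy ⟨z, h⟩).elim

variable [TopologicalSpace Z]

lemma continuous_collarMap [T2Space Z] (hL : IsOpenEmbedding L) : Continuous (collarMap L) := by
  have hK : IsClosed (L '' Metric.closedBall 0 2) :=
    ((isCompact_closedBall 0 2).image hL.continuous).isClosed
  refine continuous_iff_continuousAt.mpr fun y ↦ ?_
  by_cases hy : y ∈ Set.range L
  · obtain ⟨x, rfl⟩ := hy
    rw [← hL.continuousAt_iff]
    have : collarMap L ∘ L = fun z ↦ ((min (‖z‖ / 2) 1 : ℝ) : UnitAddCircle) :=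
      funext (collarMap_apply hL.injective)
    rw [this]
    exact ((AddCircle.continuous_mk' (1 : ℝ)).comp (by fun_prop)).continuousAt
  · refine (continuousAt_const (y := (0 : UnitAddCircle))).congr ?_
    have : y ∈ (L '' Metric.closedBall 0 2)ᶜ := fun ⟨x, _, h⟩ ↦ hy ⟨x, h⟩
    filter_upwards [hK.isOpen_compl.mem_nhds this] with z hz
    by_cases hz' : z ∈ Set.range L
    · obtain ⟨x, rfl⟩ := hz'
      have hx : 2 ≤ ‖x‖ := by
        by_contra! h
        exact hz ⟨x, by simpa using h.le, rfl⟩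
      rw [collarMap_apply hL.injective, min_eq_right (by linarith), coe_one_unitAddCircle]
    · exact (collarMap_of_notMem hz').symm

/-- Removing a closed ball from the interior of an embedded open ball does not disconnect. -/
lemma IsPreconnected.diff_closedBall [T2Space Z] (hL : IsOpenEmbedding L) {S : Set Z}
    (hS : IsPreconnected S) (hLS : Set.range L ⊆ S) :
    IsPreconnected (S \ L '' Metric.closedBall 0 1) := by
  refine hS.diff_of_diff ((isCompact_closedBall 0 1).image hL.continuous).isClosed
    hL.isOpen_range (Set.image_subset_range _ _) hLS ?_
  have : Set.range L \ L '' Metric.closedBall 0 1 = L '' (Metric.closedBall 0 1)ᶜ := by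
    rw [← Set.image_univ, ← Set.image_sdiff hL.injective, Set.compl_eq_univ_sdiff]
  rw [this]
  refine IsPreconnected.image ?_ _ hL.continuous.continuousOn
  have hs : IsConnected (Metric.sphere (0 : E3) 1) :=
    isConnected_sphere (by rw [← Module.finrank_eq_rank]; simp) 0 zero_le_one
  have hp := (isPreconnected_Ioi (a := (1 : ℝ))).prod hs.isPreconnected
  convert hp.image (fun z ↦ z.1 • z.2) (by fun_prop)
  ext x
  simp only [Set.mem_compl_iff, mem_closedBall_zero_iff, not_le, Set.mem_image, Set.mem_prod,
    Set.mem_Ioi, mem_sphere_zero_iff_norm, Prod.exists]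
  constructor
  · intro hx
    refine ⟨‖x‖, ‖x‖⁻¹ • x, ⟨hx, ?_⟩, ?_⟩
    · rw [norm_smul, norm_inv, norm_norm, inv_mul_cancel₀ (by linarith)]
    · rw [smul_smul, mul_inv_cancel₀ (by linarith), one_smul]
  · rintro ⟨t, y, ⟨ht, hy⟩, rfl⟩
    rw [norm_smul, hy, mul_one, Real.norm_of_nonneg (by linarith)]
    exact ht

end EmbeddedBalls

/-! ### The covering space pulled back along the two pinch maps -/

section PinchCover

open unitInterval Topology

lemma isPreconnected_of_image_val {X : Type*} [TopologicalSpace X] {p : X → Prop}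
    {C : Set {x // p x}} (h : IsPreconnected (Subtype.val '' C)) : IsPreconnected C :=
  IsInducing.subtypeVal.isPreconnected_image.mp h

/-- The triple cover of `A` on which `f` acquires a cube root. -/
abbrev TripleCover {A : Type*} [TopologicalSpace A] (f : C(A, UnitAddCircle)) : Type _ :=
  {z : A × UnitAddCircle // f z.1 = 3 • z.2}

/-- The pullback to `M` of the product of the triple cover of the circle and of `q`, along the
product of `f ∘ S.pinch` and `T.pinch`. -/
abbrev PinchCover {A B B' M : Type*} [TopologicalSpace A] [TopologicalSpace B] [TopologicalSpace M]
    (S : ConnectSumSide A M) (T : ConnectSumSide B M) (f : C(A, UnitAddCircle)) (q : B' → B) :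
    Type _ :=
  {w : M × (UnitAddCircle × B') //
    (f (S.pinch w.1), T.pinch w.1) = Prod.map (fun s : UnitAddCircle ↦ 3 • s) q w.2}

variable {A B B' M : Type*} [TopologicalSpace A] [TopologicalSpace B]
  [TopologicalSpace M] (S : ConnectSumSide A M) (T : ConnectSumSide B M)
  (f : C(A, UnitAddCircle)) {F : C(E3, ℝ)} (hF : ∀ z, (F z : UnitAddCircle) = f (S.ball z))

/-- The three lifts to the triple cover of the chart `S.ball`, given a real lift `F` of `f` in this
chart. -/
noncomputable def sheet (i : Fin 3) (z : E3) : TripleCover f :=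
  ⟨(S.ball z, ((((F z + (i : ℕ)) / 3 : ℝ)) : UnitAddCircle)), by
    rw [← AddCircle.coe_nsmul, ← hF, unitAddCircle_coe_eq_coe]
    exact ⟨-(i : ℕ), by simp; ring⟩⟩

lemma continuous_sheet (i : Fin 3) : Continuous (sheet S f hF i) := by
  have h1 := S.isOpenEmbedding.continuous
  have h2 : Continuous fun z ↦ (((F z + (i : ℕ)) / 3 : ℝ) : UnitAddCircle) :=
    (AddCircle.continuous_mk' (1 : ℝ)).comp (by fun_prop)
  exact (h1.prodMk h2).subtype_mk _

lemma injective_sheet (i : Fin 3) : Function.Injective (sheet S f hF i) := fun _ _ h ↦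
  S.isOpenEmbedding.injective (congrArg (fun e : TripleCover f ↦ e.1.1) h)

lemma isOpenEmbedding_sheet (i : Fin 3) : IsOpenEmbedding (sheet S f hF i) := by
  have hp := (isCoveringMap_three_nsmul.pullback_fst f.continuous).isLocalHomeomorph
  have : IsLocalHomeomorph (sheet S f hF i) :=
    .of_comp (g := fun e : TripleCover f ↦ e.1.1) S.isOpenEmbedding.isLocalHomeomorph hp
      (continuous_sheet S f hF i)
  exact .of_continuous_injective_isOpenMap this.continuous (injective_sheet S f hF i) this.isOpenMap

/-- The three lifts have disjoint images. -/
lemma eq_of_sheet_eq {i j : Fin 3} {z w : E3} (h : sheet S f hF i z = sheet S f hF j w) :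
    i = j := by
  obtain rfl : z = w :=
    S.isOpenEmbedding.injective (congrArg (fun e : TripleCover f ↦ e.1.1) h)
  have h2 : ((((F z + (i : ℕ)) / 3 : ℝ)) : UnitAddCircle) =
    ((((F z + (j : ℕ)) / 3 : ℝ)) : UnitAddCircle) := congrArg (fun e : TripleCover f ↦ e.1.2) h
  obtain ⟨n, hn⟩ := unitAddCircle_coe_eq_coe.mp h2
  have h3 : ((i : ℕ) : ℝ) - (j : ℕ) = 3 * n := by rw [← hn]; ring
  have h3 : ((i : ℕ) : ℤ) - (j : ℕ) = 3 * n := by exact_mod_cast h3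
  have := i.2
  have := j.2
  exact Fin.ext (by omega)

/-- The three lifts cover the part of the triple cover over the chart. -/
lemma exists_sheet {e : TripleCover f} {z : E3} (he : e.1.1 = S.ball z) :
    ∃ i, e = sheet S f hF i z := by
  have h0 : 3 • (e.1.2 - (sheet S f hF 0 z).1.2) = 0 := by
    rw [smul_sub, ← e.2, ← (sheet S f hF 0 z).2, he]
    exact sub_self _
  have key (i : Fin 3) (h : e.1.2 - (sheet S f hF 0 z).1.2 = (((i : ℕ) / 3 : ℝ) : UnitAddCircle)) :
      e = sheet S f hF i z := by
    refine Subtype.ext (Prod.ext he ?_)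
    rw [sub_eq_iff_eq_add] at h
    rw [h]
    change _ + (((F z + ((0 : Fin 3) : ℕ)) / 3 : ℝ) : UnitAddCircle) =
      (((F z + (i : ℕ)) / 3 : ℝ) : UnitAddCircle)
    rw [← AddCircle.coe_add]
    congr 1
    simp
    ring
  rcases eq_of_three_nsmul_eq_zero h0 with h | h | h
  · exact ⟨0, key 0 (by simpa using h)⟩
  · exact ⟨1, key 1 (by rw [h]; simp)⟩
  · refine ⟨2, key 2 ?_⟩
    rw [h, ← AddCircle.coe_add]
    congr 1
    norm_num

lemma collarMap_sheet_of_ne {i j : Fin 3} (h : i ≠ j) (z : E3) :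
    collarMap (sheet S f hF i) (sheet S f hF j z) = 0 :=
  collarMap_of_notMem fun ⟨_, hw⟩ ↦ h (eq_of_sheet_eq S f hF hw)

variable {S T f} {q : B' → B}

/-- The projection of the pinch cover to the triple cover of `A`. -/
noncomputable def PinchCover.toTriple (w : PinchCover S T f q) : TripleCover f :=
  ⟨(S.pinch w.1.1, w.1.2.1), (Prod.ext_iff.mp w.2).1⟩

lemma PinchCover.pinch_eq (w : PinchCover S T f q) : T.pinch w.1.1 = q w.1.2.2 :=
  (Prod.ext_iff.mp w.2).2

/-- The point of the pinch cover over `x ∈ S.image` in the piece with label `b` and with projection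
`e` to the triple cover. Over `S.image` the label of a point is its coordinate in the fibre of `q`
over the centre of the ball in `B`. -/
noncomputable def pinchCoverMk (hTS : T.other = S.image) {b : B'} (hb : q b = T.ball 0) {x : M}
    (hx : x ∈ S.image) (e : TripleCover f) (he : S.pinch x = e.1.1) : PinchCover S T f q :=
  ⟨(x, (e.1.2, b)), Prod.ext (by simp only [he]; exact e.2)
    ((T.pinch_of_mem_other (hTS ▸ hx)).trans hb.symm)⟩

lemma toTriple_pinchCoverMk (hTS : T.other = S.image) {b : B'} (hb : q b = T.ball 0) {x : M}
    (hx : x ∈ S.image) (e : TripleCover f) (he : S.pinch x = e.1.1) :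
    (pinchCoverMk hTS hb hx e he).toTriple = e :=
  Subtype.ext (Prod.ext he rfl)

open Classical in
/-- The circle map on the pinch cover that is dual to the `i`-th of the three spheres lying over the
connect sum sphere in the piece with label `b₀`. Over the other side of `M` the circle map of the
embedded ball vanishes, because the pinch map has the centre of the ball as its value there. -/
noncomputable def sphereClass (b₀ : B') (i : Fin 3) (w : PinchCover S T f q) : UnitAddCircle :=
  if w.1.1 ∈ S.image ∧ w.1.2.2 = b₀ then collarMap (sheet S f hF i) w.toTriple else 0

variable {b₀ : B'}

lemma sphereClass_of_mem_other (i : Fin 3) {w : PinchCover S T f q} (hw : w.1.1 ∈ S.other) :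
    sphereClass hF b₀ i w = 0 := by
  unfold sphereClass
  split_ifs with h
  · obtain ⟨j, hj⟩ := exists_sheet S f hF (e := w.toTriple) (z := 0) (S.pinch_of_mem_other hw)
    rw [hj]
    by_cases hij : i = j
    · rw [hij, collarMap_apply_zero (injective_sheet S f hF j)]
    · exact collarMap_sheet_of_ne S f hF hij 0
  · rfl

lemma sphereClass_of_ne (i : Fin 3) {w : PinchCover S T f q} (hw : w.1.2.2 ≠ b₀) :
    sphereClass hF b₀ i w = 0 := if_neg fun h ↦ hw h.2

lemma sphereClass_eq (i : Fin 3) {w : PinchCover S T f q} (hw : w.1.1 ∈ S.image)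
    (hb : w.1.2.2 = b₀) : sphereClass hF b₀ i w = collarMap (sheet S f hF i) w.toTriple :=
  if_pos ⟨hw, hb⟩

lemma sphereClass_eq_half_iff (i : Fin 3) {w : PinchCover S T f q} :
    sphereClass hF b₀ i w = ((1 / 2 : ℝ) : UnitAddCircle) ↔
      w.1.1 ∈ S.image ∧ w.1.2.2 = b₀ ∧ ∃ z, ‖z‖ = 1 ∧ sheet S f hF i z = w.toTriple := by
  unfold sphereClass
  split_ifs with h
  · rw [collarMap_eq_half_iff (injective_sheet S f hF i)]
    tauto
  · exact ⟨fun h' ↦ (zero_ne_half h').elim, fun h' ↦ (h ⟨h'.1, h'.2.1⟩).elim⟩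

/-- The `i`-th lift to the piece with label `b₀` of the complement of the open unit ball in the
chart `S.ball`. -/
noncomputable def collar (hTS : T.other = S.image) (hb₀ : q b₀ = T.ball 0) (i : Fin 3)
    (y : {y : E3 // 1 ≤ ‖y‖}) : PinchCover S T f q :=
  pinchCoverMk hTS hb₀ (S.incl_ball_mem_image y.2) (sheet S f hF i (collapse y))
    (S.pinch_incl_ball y.2)

lemma sphereClass_collar (hTS : T.other = S.image) (hb₀ : q b₀ = T.ball 0) (i j : Fin 3)
    (y : {y : E3 // 1 ≤ ‖y‖}) : sphereClass hF b₀ j (collar hF hTS hb₀ i y) =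
      collarMap (sheet S f hF j) (sheet S f hF i (collapse y)) := by
  rw [sphereClass_eq hF (b₀ := b₀) j (w := collar hF hTS hb₀ i y) (S.incl_ball_mem_image y.2) rfl]
  congr 1
  exact toTriple_pinchCoverMk ..

lemma uncollapse_of_norm_eq_one {z : E3} (hz : ‖z‖ = 1) : uncollapse z = (3 / 2 : ℝ) • z := by
  rw [uncollapse, hz]
  norm_num

/-- The points of the `i`-th sphere: `collapse` maps the radius `3 / 2` to the radius `1`, which is
where `collarMap` has the value `1/2`. -/
lemma eq_collar_of_sphereClass_eq_half (hTS : T.other = S.image) (hb₀ : q b₀ = T.ball 0) (i : Fin 3)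
    {w : PinchCover S T f q} (hw : sphereClass hF b₀ i w = ((1 / 2 : ℝ) : UnitAddCircle)) :
    ∃ z : E3, ‖z‖ = 1 ∧ ∀ h : 1 ≤ ‖(3 / 2 : ℝ) • z‖,
      w = collar hF hTS hb₀ i ⟨(3 / 2 : ℝ) • z, h⟩ := by
  obtain ⟨h1, h2, z, hz, h3⟩ := (sphereClass_eq_half_iff hF i).mp hw
  have hz0 : z ≠ 0 := fun h ↦ by simp [h] at hz
  refine ⟨z, hz, fun h ↦ ?_⟩
  have h4 : S.pinch w.1.1 = S.ball z := (congrArg (fun e : TripleCover f ↦ e.1.1) h3).symm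
  have h5 : w.1.2.1 = (sheet S f hF i z).1.2 :=
    (congrArg (fun e : TripleCover f ↦ e.1.2) h3).symm
  rw [S.pinch_eq_ball_iff hz0, uncollapse_of_norm_eq_one hz] at h4
  refine Subtype.ext (Prod.ext h4 (Prod.ext ?_ h2))
  rw [h5]
  change _ = (sheet S f hF i (collapse ((3 / 2 : ℝ) • z))).1.2
  rw [← uncollapse_of_norm_eq_one hz, collapse_uncollapse hz0]

variable [TopologicalSpace B']

lemma PinchCover.continuous_toTriple [T2Space A] :
    Continuous (PinchCover.toTriple : PinchCover S T f q → TripleCover f) := by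
  have := S.continuous_pinch
  unfold PinchCover.toTriple
  fun_prop

/-- The part of the pinch cover over the side of `A` is a disjoint union of copies of the triple
cover with the ball removed, and each preconnected set in the triple cover has a preconnected
preimage in each of them. -/
lemma isPreconnected_partA [CompactSpace M] [T2Space A] (hTS : T.other = S.image) {b : B'}
    (hb : q b = T.ball 0) {G : Set (TripleCover f)} (hG : IsPreconnected G) :
    IsPreconnected {w : PinchCover S T f q |
      w.1.1 ∈ S.image ∧ w.1.2.2 = b ∧ w.toTriple ∈ G} := by
  refine isPreconnected_of_image_val ?_
  have hP := isPreconnected_fiberProduct S.isClosed_image S.continuous_pinch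
    (p := fun e : TripleCover f ↦ e.1.1) (by fun_prop) hG
    fun e _ ↦ S.isConnected_fiber_pinch e.1.1
  convert hP.image (fun z ↦ (z.1, (z.2.1.2, b))) (by fun_prop)
  ext z
  constructor
  · rintro ⟨w, ⟨h1, h2, h3⟩, rfl⟩
    exact ⟨(w.1.1, PinchCover.toTriple w), ⟨h1, rfl, h3⟩, Prod.ext rfl (Prod.ext rfl h2.symm)⟩
  · rintro ⟨⟨x, e⟩, ⟨h1, h2, h3⟩, rfl⟩
    refine ⟨pinchCoverMk hTS hb h1 e h2, ⟨h1, rfl, ?_⟩, rfl⟩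
    exact (congrArg (· ∈ G) (toTriple_pinchCoverMk hTS hb h1 e h2)).mpr h3

/-- The part of the pinch cover over the side of `B` is a disjoint union of preconnected pieces. -/
lemma isPreconnected_partB [CompactSpace M] [T2Space B] [PreconnectedSpace B'] (hq : Continuous q)
    (hST : S.other = T.image) {s : UnitAddCircle} (hs : f (S.ball 0) = 3 • s) :
    IsPreconnected {w : PinchCover S T f q | w.1.1 ∈ T.image ∧ w.1.2.1 = s} := by
  refine isPreconnected_of_image_val ?_
  have hP := isPreconnected_fiberProduct T.isClosed_image T.continuous_pinch hq
    isPreconnected_univ fun e _ ↦ T.isConnected_fiber_pinch (q e)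
  convert hP.image (fun z ↦ (z.1, (s, z.2))) (by fun_prop)
  ext z
  constructor
  · rintro ⟨w, ⟨h1, h2⟩, rfl⟩
    exact ⟨(w.1.1, w.1.2.2), ⟨h1, PinchCover.pinch_eq w, trivial⟩,
      Prod.ext rfl (Prod.ext h2.symm rfl)⟩
  · rintro ⟨⟨x, b⟩, ⟨h1, h2, -⟩, rfl⟩
    refine ⟨⟨(x, (s, b)), Prod.ext ?_ h2⟩, ⟨h1, rfl⟩, rfl⟩
    dsimp only [Prod.map]
    rw [S.pinch_of_mem_other (hST ▸ h1)]
    exact hs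

lemma continuous_sphereClass [T2Space A] [T1Space B'] (hTS : T.other = S.image)
    (hfin : (q ⁻¹' {T.ball 0}).Finite) (i : Fin 3) :
    Continuous (sphereClass hF b₀ i : PinchCover S T f q → UnitAddCircle) := by
  have hc1 : Continuous fun w : PinchCover S T f q ↦ w.1.1 := by fun_prop
  have hc2 : Continuous fun w : PinchCover S T f q ↦ w.1.2.2 := by fun_prop
  have h1 : IsClosed {w : PinchCover S T f q | w.1.1 ∈ S.image ∧ w.1.2.2 = b₀} :=
    (S.isClosed_image.preimage hc1).inter (isClosed_singleton.preimage hc2)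
  have h2 : IsClosed ({w : PinchCover S T f q | w.1.1 ∈ S.other} ∪
      {w | w.1.2.2 ∈ q ⁻¹' {T.ball 0} \ {b₀}}) :=
    (S.isClosed_other.preimage hc1).union
      ((hfin.subset Set.sdiff_subset).isClosed.preimage hc2)
  have hcov : {w : PinchCover S T f q | w.1.1 ∈ S.image ∧ w.1.2.2 = b₀} ∪
      ({w : PinchCover S T f q | w.1.1 ∈ S.other} ∪ {w | w.1.2.2 ∈ q ⁻¹' {T.ball 0} \ {b₀}}) =
      Set.univ := by
    refine Set.eq_univ_of_forall fun w ↦ ?_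
    by_cases hb : w.1.2.2 = b₀
    · rcases (show w.1.1 ∈ S.image ∪ S.other from S.cover ▸ Set.mem_univ _) with h | h
      · exact .inl ⟨h, hb⟩
      · exact .inr (.inl h)
    · rcases (show w.1.1 ∈ S.image ∪ S.other from S.cover ▸ Set.mem_univ _) with h | h
      · refine .inr (.inr ⟨?_, hb⟩)
        rw [Set.mem_preimage, ← w.pinch_eq, T.pinch_of_mem_other (hTS ▸ h)]
        rfl
      · exact .inr (.inl h)
  rw [← continuousOn_univ, ← hcov]
  refine ContinuousOn.union_of_isClosed ?_ ?_ h1 h2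
  · exact ((continuous_collarMap (isOpenEmbedding_sheet S f hF i)).comp
      PinchCover.continuous_toTriple).continuousOn.congr fun w hw ↦ sphereClass_eq hF i hw.1 hw.2
  · refine (continuousOn_const (c := (0 : UnitAddCircle))).congr ?_
    rintro w (hw | hw)
    · exact sphereClass_of_mem_other hF i hw
    · exact sphereClass_of_ne hF i hw.2

lemma continuous_collar (hTS : T.other = S.image) (hb₀ : q b₀ = T.ball 0) (i : Fin 3) :
    Continuous (collar hF hTS hb₀ i) := by
  have h1 : Continuous fun y : {y : E3 // 1 ≤ ‖y‖} ↦ S.incl (S.ball y) :=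
    S.continuousOn_incl.comp_continuous
      (S.isOpenEmbedding.continuous.comp continuous_subtype_val) fun y ↦ S.ball_mem_compl y.2
  have h2 : Continuous fun y : {y : E3 // 1 ≤ ‖y‖} ↦ (sheet S f hF i (collapse y)).1.2 :=
    (continuous_snd.comp continuous_subtype_val).comp
      ((continuous_sheet S f hF i).comp (continuous_collapse.comp continuous_subtype_val))
  exact (h1.prodMk (h2.prodMk continuous_const)).subtype_mk _

lemma norm_add_one_smul {z : E3} (hz : ‖z‖ = 1) (t : I) : ‖(1 + (t : ℝ)) • z‖ = 1 + t := by
  have := t.2.1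
  rw [norm_smul, hz, mul_one, Real.norm_of_nonneg (by linarith)]

/-- The `i`-th sphere is crossed by radial paths, which are disjoint from the `j`-th sphere. -/
lemma hasTransversals_sphereClass (hTS : T.other = S.image) (hb₀ : q b₀ = T.ball 0) {i j : Fin 3}
    (hij : i ≠ j) (u v : C(PinchCover S T f q, UnitAddCircle))
    (hu : ∀ w, u w = sphereClass hF b₀ i w)
    (hv : ∀ w, v w = sphereClass hF b₀ j w) : HasTransversals u v := by
  intro w hw
  rw [hu] at hw
  obtain ⟨z, hz, hwz⟩ := eq_collar_of_sphereClass_eq_half hF hTS hb₀ i hw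
  refine ⟨⟨fun t ↦ collar hF hTS hb₀ i ⟨(1 + (t : ℝ)) • z, ?_⟩, ?_⟩,
    ⟨⟨1 / 2, by norm_num⟩, ?_⟩, ?_, ?_⟩
  · rw [norm_add_one_smul hz]
    linarith [t.2.1]
  · exact (continuous_collar hF hTS hb₀ i).comp (by fun_prop)
  · rw [hwz (by rw [norm_smul, hz]; norm_num)]
    simp only [ContinuousMap.coe_mk]
    congr 2
    norm_num
  · intro t
    have h1 : ‖collapse ((1 + (t : ℝ)) • z)‖ = 2 * t := by
      rw [norm_collapse, norm_add_one_smul hz]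
      · ring
      · rw [norm_add_one_smul hz]; linarith [t.2.1]
      · rw [norm_add_one_smul hz]; linarith [t.2.2]
    simp only [ContinuousMap.coe_mk]
    rw [hu, sphereClass_collar, collarMap_apply (injective_sheet S f hF i), h1]
    congr 1
    rw [mul_div_cancel_left₀ _ two_ne_zero, min_eq_left t.2.2]
  · intro t
    simp only [ContinuousMap.coe_mk]
    rw [hv, sphereClass_collar, collarMap_sheet_of_ne S f hF hij.symm]

/-- The complement in the pinch cover of two of the three spheres in the piece with label `b₀` is
connected. The pieces over the side of `A`, labelled by the fibre of `q`, and those over the side of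
`B`, labelled by the three points of the circle, form a complete bipartite graph. Two edges at the
vertex `b₀` are cut; the third keeps the piece `b₀` attached, and the other pieces are attached to
each other through a vertex `b₁ ≠ b₀`. -/
lemma isConnected_compl_spheres [CompactSpace M] [T2Space A] [T2Space B] [PreconnectedSpace B']
    [PreconnectedSpace (TripleCover f)] (hq : Continuous q) (hTS : T.other = S.image)
    (hST : S.other = T.image) (hb₀ : q b₀ = T.ball 0) {b₁ : B'} (hb₁ : q b₁ = T.ball 0)
    (hb : b₁ ≠ b₀) :
    IsConnected {w : PinchCover S T f q |
      sphereClass hF b₀ 0 w ≠ ((1 / 2 : ℝ) : UnitAddCircle) ∧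
      sphereClass hF b₀ 1 w ≠ ((1 / 2 : ℝ) : UnitAddCircle)} := by
  set O := {w : PinchCover S T f q | sphereClass hF b₀ 0 w ≠ ((1 / 2 : ℝ) : UnitAddCircle) ∧
      sphereClass hF b₀ 1 w ≠ ((1 / 2 : ℝ) : UnitAddCircle)} with hO
  -- the part of the piece `b` over the side of `A` that projects to `G`, and the pieces of `B`
  let P (G : Set (TripleCover f)) (b : B') : Set (PinchCover S T f q) :=
    {w | w.1.1 ∈ S.image ∧ w.1.2.2 = b ∧ w.toTriple ∈ G}
  let Q (k : Fin 3) : Set (PinchCover S T f q) :=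
    {w | w.1.1 ∈ T.image ∧ w.1.2.1 = (sheet S f hF k 0).1.2}
  have hP (G : Set (TripleCover f)) (hG : IsPreconnected G) (b : B') (hb : q b = T.ball 0) :
      IsPreconnected (P G b) := isPreconnected_partA hTS hb hG
  have hQ (k : Fin 3) : IsPreconnected (Q k) := isPreconnected_partB hq hST (sheet S f hF k 0).2
  -- a point where the two sides meet
  obtain ⟨x, hxS, hx⟩ := (S.isConnected_fiber_pinch (S.ball 0)).nonempty
  have hxT : x ∈ T.image := hST ▸ S.pinch_eq_ball_zero_iff.mp hx
  let c (k : Fin 3) (b : B') (hb : q b = T.ball 0) : PinchCover S T f q :=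
    pinchCoverMk hTS hb hxS (sheet S f hF k 0) hx
  have hcP (k : Fin 3) (b : B') (hb : q b = T.ball 0) (G : Set (TripleCover f))
      (hG : sheet S f hF k 0 ∈ G) : c k b hb ∈ P G b := by
    refine ⟨hxS, rfl, ?_⟩
    rwa [show (c k b hb).toTriple = sheet S f hF k 0 from toTriple_pinchCoverMk ..]
  have hcQ (k : Fin 3) (b : B') (hb : q b = T.ball 0) : c k b hb ∈ Q k := ⟨hxT, rfl⟩
  have hQO (k : Fin 3) : Q k ⊆ O := fun w hw ↦ by
    have hw' : w.1.1 ∈ S.other := hST ▸ hw.1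
    rw [hO, Set.mem_ofPred_eq, sphereClass_of_mem_other hF 0 hw', sphereClass_of_mem_other hF 1 hw']
    exact ⟨zero_ne_half, zero_ne_half⟩
  have hPO (G : Set (TripleCover f)) (b : B') (hb : b ≠ b₀) : P G b ⊆ O := fun w hw ↦ by
    have hw' : w.1.2.2 ≠ b₀ := hw.2.1 ▸ hb
    rw [hO, Set.mem_ofPred_eq, sphereClass_of_ne hF 0 hw', sphereClass_of_ne hF 1 hw']
    exact ⟨zero_ne_half, zero_ne_half⟩
  have hbase : c 0 b₁ hb₁ ∈ O := hQO 0 (hcQ 0 b₁ hb₁)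
  have hjoin (k : Fin 3) (G : Set (TripleCover f)) (hG : IsPreconnected G) (b : B')
      (hb : q b = T.ball 0) (hk : sheet S f hF k 0 ∈ G) :
      IsPreconnected (P Set.univ b₁ ∪ (Q k ∪ P G b)) :=
    (hP _ isPreconnected_univ b₁ hb₁).union (c k b₁ hb₁) (hcP k b₁ hb₁ _ trivial)
      (.inl (hcQ k b₁ hb₁))
      ((hQ k).union (c k b hb) (hcQ k b hb) (hcP k b hb G hk) (hP G hG b hb))
  have hfin (w : PinchCover S T f q) (k : Fin 3) (G : Set (TripleCover f)) (hG : IsPreconnected G)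
      (b : B') (hb' : q b = T.ball 0) (hk : sheet S f hF k 0 ∈ G) (hGO : P G b ⊆ O)
      (hw : w ∈ Q k ∪ P G b) :
      ∃ t ⊆ O, c 0 b₁ hb₁ ∈ t ∧ w ∈ t ∧ IsPreconnected t :=
    ⟨P Set.univ b₁ ∪ (Q k ∪ P G b), Set.union_subset (hPO _ b₁ hb) (Set.union_subset (hQO k) hGO),
      .inl (hcP 0 b₁ hb₁ _ trivial), .inr hw, hjoin k G hG b hb' hk⟩
  refine ⟨⟨_, hbase⟩, isPreconnected_of_forall (c 0 b₁ hb₁) fun w hw ↦ ?_⟩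
  rcases (show w.1.1 ∈ S.image ∪ S.other from S.cover ▸ Set.mem_univ _) with h | h
  swap
  · obtain ⟨k, hk⟩ := exists_sheet S f hF (e := w.toTriple) (S.pinch_of_mem_other h)
    exact hfin w k Set.univ isPreconnected_univ b₁ hb₁ trivial (hPO _ b₁ hb)
      (.inl ⟨hST ▸ h, congrArg (fun e : TripleCover f ↦ e.1.2) hk⟩)
  have hwq : q w.1.2.2 = T.ball 0 := by rw [← w.pinch_eq, T.pinch_of_mem_other (hTS ▸ h)]
  by_cases hwb : w.1.2.2 = b₀
  swap
  · exact hfin w 0 Set.univ isPreconnected_univ _ hwq trivial (hPO _ _ hwb) (.inr ⟨h, rfl, trivial⟩)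
  have hdisj (i j : Fin 3) (hij : i ≠ j) (z : E3) (K : Set E3) :
      sheet S f hF i z ∉ sheet S f hF j '' K := fun ⟨_, _, h⟩ ↦ hij (eq_of_sheet_eq S f hF h).symm
  by_cases hG : w.toTriple ∈ (Set.univ \ sheet S f hF 0 '' Metric.closedBall 0 1) \
      sheet S f hF 1 '' Metric.closedBall 0 1
  -- the piece `b₀` outside the two spheres, attached through the third
  · refine hfin w 2 ((Set.univ \ sheet S f hF 0 '' Metric.closedBall 0 1) \
      sheet S f hF 1 '' Metric.closedBall 0 1) ?_ b₀ hb₀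
      ⟨⟨trivial, hdisj 2 0 (by decide) 0 _⟩, hdisj 2 1 (by decide) 0 _⟩ ?_ (.inr ⟨h, hwb, hG⟩)
    · refine (isPreconnected_univ.diff_closedBall (isOpenEmbedding_sheet S f hF 0)
        (Set.subset_univ _)).diff_closedBall (isOpenEmbedding_sheet S f hF 1) ?_
      rintro _ ⟨z, rfl⟩
      exact ⟨trivial, hdisj 1 0 (by decide) z _⟩
    · rintro w ⟨-, -, hw0, hw1⟩
      refine ⟨fun h ↦ ?_, fun h ↦ ?_⟩
      · obtain ⟨-, -, z, hz, h⟩ := (sphereClass_eq_half_iff hF 0).mp h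
        exact hw0.2 ⟨z, by simp [hz], h⟩
      · obtain ⟨-, -, z, hz, h⟩ := (sphereClass_eq_half_iff hF 1).mp h
        exact hw1 ⟨z, by simp [hz], h⟩
  -- the remaining points lie inside one of the two spheres, which attaches them to the side of `B`
  have hin (i : Fin 3) (hi : w.toTriple ∈ sheet S f hF i '' Metric.closedBall 0 1)
      (hwi : sphereClass hF b₀ i w ≠ ((1 / 2 : ℝ) : UnitAddCircle)) :
      ∃ t ⊆ O, c 0 b₁ hb₁ ∈ t ∧ w ∈ t ∧ IsPreconnected t := by
    obtain ⟨z, hz, hzw⟩ := hi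
    have hz1 : ‖z‖ < 1 := by
      refine lt_of_le_of_ne (by simpa using hz) fun hz1 ↦ hwi ?_
      exact (sphereClass_eq_half_iff hF i).mpr ⟨h, hwb, z, hz1, hzw⟩
    refine hfin w i (sheet S f hF i '' Metric.ball 0 1) ?_ b₀ hb₀ ⟨0, by simp, rfl⟩ ?_
      (.inr ⟨h, hwb, z, by simpa using hz1, hzw⟩)
    · exact (convex_ball (0 : E3) 1).isPreconnected.image _ (continuous_sheet S f hF i).continuousOn
    · rintro w ⟨-, -, y, hy, hyw⟩
      have hno (j : Fin 3) : sphereClass hF b₀ j w ≠ ((1 / 2 : ℝ) : UnitAddCircle) := fun h ↦ by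
        obtain ⟨-, -, z, hz, h⟩ := (sphereClass_eq_half_iff hF j).mp h
        rw [← hyw] at h
        obtain rfl := eq_of_sheet_eq S f hF h
        rw [← injective_sheet S f hF j h, mem_ball_zero_iff] at hy
        exact hy.ne hz
      exact ⟨hno 0, hno 1⟩
  by_cases h0 : w.toTriple ∈ sheet S f hF 0 '' Metric.closedBall 0 1
  · exact hin 0 h0 hw.1
  · refine hin 1 ?_ hw.2
    by_contra h1
    exact hG ⟨⟨trivial, h0⟩, h1⟩

end PinchCover

/-! ### The lifted spheres and the covering space -/

section PinchCoverSphere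

open Topology

variable {A B B' M : Type*} [TopologicalSpace A] [TopologicalSpace B] [TopologicalSpace M]
  {S : ConnectSumSide A M} {T : ConnectSumSide B M} {f : C(A, UnitAddCircle)} {F : C(E3, ℝ)}
  (hF : ∀ z, (F z : UnitAddCircle) = f (S.ball z)) {q : B' → B} {b₀ : B'}

lemma card_fiber_pinchCover {n : ℕ} (hq : ∀ b, Nat.card (q ⁻¹' {b}) = n) (x : M) :
    Nat.card ((fun w : PinchCover S T f q ↦ w.1.1) ⁻¹' {x}) = 3 * n := by
  refine Eq.trans ?_ (congrArg₂ (· * ·) (card_three_nsmul_eq (f (S.pinch x))) (hq (T.pinch x)))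
  refine (Nat.card_congr ?_).trans (Nat.card_prod _ _)
  refine {
    toFun w := (⟨w.1.1.2.1, ?_⟩, ⟨w.1.1.2.2, ?_⟩)
    invFun z := ⟨⟨(x, (z.1.1, z.2.1)), ?_⟩, rfl⟩
    left_inv w := Subtype.ext (Subtype.ext (Prod.ext w.2.symm rfl))
    right_inv z := rfl }
  · have h : w.1.1.1 = x := w.2
    exact (Prod.ext_iff.mp w.1.2).1.symm.trans (congrArg (fun m ↦ f (S.pinch m)) h)
  · have h : w.1.1.1 = x := w.2
    exact (Prod.ext_iff.mp w.1.2).2.symm.trans (congrArg T.pinch h)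
  · exact Prod.ext (Eq.symm z.1.2) (Eq.symm z.2.2)

lemma one_le_norm_smul_sphere (v : S2) : 1 ≤ ‖(3 / 2 : ℝ) • (v : E3)‖ := by
  rw [norm_smul, norm_eq_of_mem_sphere]
  norm_num

/-- The `i`-th lift to the piece with label `b₀` of a sphere parallel to the connect sum sphere. The
radius `3 / 2` keeps it away from the connect sum sphere, where the inclusion of the side of `A` is
not a local diffeomorphism. -/
noncomputable def liftedSphere (hTS : T.other = S.image) (hb₀ : q b₀ = T.ball 0) (i : Fin 3)
    (v : S2) : PinchCover S T f q :=
  collar hF hTS hb₀ i ⟨(3 / 2 : ℝ) • (v : E3), one_le_norm_smul_sphere v⟩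

lemma sphereClass_liftedSphere (hTS : T.other = S.image) (hb₀ : q b₀ = T.ball 0) (i : Fin 3)
    (v : S2) :
    sphereClass hF b₀ i (liftedSphere hF hTS hb₀ i v) = ((1 / 2 : ℝ) : UnitAddCircle) := by
  have h : ‖(3 / 2 : ℝ) • (v : E3)‖ = 3 / 2 := by
    rw [norm_smul, norm_eq_of_mem_sphere]
    norm_num
  rw [liftedSphere, sphereClass_collar, collarMap_apply (injective_sheet S f hF i),
    norm_collapse (one_le_norm_smul_sphere v) (by rw [h]; norm_num), h]
  congr 1
  norm_num

lemma range_liftedSphere (hTS : T.other = S.image) (hb₀ : q b₀ = T.ball 0) (i : Fin 3) :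
    Set.range (liftedSphere hF hTS hb₀ i) =
      {w | sphereClass hF b₀ i w = ((1 / 2 : ℝ) : UnitAddCircle)} := by
  ext w
  constructor
  · rintro ⟨v, rfl⟩
    exact sphereClass_liftedSphere hF hTS hb₀ i v
  · intro hw
    obtain ⟨z, hz, h⟩ := eq_collar_of_sphereClass_eq_half hF hTS hb₀ i hw
    exact ⟨⟨z, by simpa using hz⟩, (h _).symm⟩

lemma injective_liftedSphere (hTS : T.other = S.image) (hb₀ : q b₀ = T.ball 0) (i : Fin 3) :
    Function.Injective (liftedSphere hF hTS hb₀ i) := by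
  intro v w h
  have h1 : S.incl (S.ball ((3 / 2 : ℝ) • (v : E3))) = S.incl (S.ball ((3 / 2 : ℝ) • (w : E3))) :=
    congrArg (fun z : PinchCover S T f q ↦ z.1.1) h
  have h2 := S.isOpenEmbedding.injective (S.ret_incl.injOn
    (S.ball_mem_compl (one_le_norm_smul_sphere v))
    (S.ball_mem_compl (one_le_norm_smul_sphere w)) h1)
  exact Subtype.ext (smul_right_injective E3 (by norm_num : (3 / 2 : ℝ) ≠ 0) h2)

end PinchCoverSphere

theorem lemma2 (A B M : Type u)
    [TopologicalSpace A] [T2Space A] [ChartedSpace (EuclideanHalfSpace 3) A]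
    [IsManifold (𝓡∂ 3) ∞ A]
    [TopologicalSpace B] [T2Space B] [ChartedSpace (EuclideanHalfSpace 3) B]
    [IsManifold (𝓡∂ 3) ∞ B]
    [TopologicalSpace M] [T2Space M] [ChartedSpace (EuclideanHalfSpace 3) M]
    [IsManifold (𝓡∂ 3) ∞ M] [CompactSpace M] [ConnectedSpace M]
    (D : ConnectSumDecomposition A B M)
    (hA : 1 ≤ bettiOne A)
    (hB : ∃ (B' : Type u) (_ : TopologicalSpace B') (q : B' → B) (n : ℕ),
      2 ≤ n ∧ IsConnectedCovering q n) :
    ∃ (M' : Type u) (_ : TopologicalSpace M') (_ : ChartedSpace (EuclideanHalfSpace 3) M')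
      (p : M' → M) (n : ℕ) (σ : S2 → M'),
      T2Space M' ∧ IsManifold (𝓡∂ 3) ∞ M' ∧
      IsConnectedCovering p n ∧ IsLocalDiffeomorph (𝓡∂ 3) (𝓡∂ 3) ∞ p ∧
      2 ≤ bettiOne M' ∧
      IsEmbeddedSphere σ ∧ IsNonseparating σ := by
  obtain ⟨B', _, q, n, hn, hq⟩ := hB
  set S := D.sideA
  set T := D.sideB
  have hST : S.other = T.image := rfl
  have hTS : T.other = S.image := rfl
  -- the pinch map exhibits `A` as a quotient of `M`
  have : CompactSpace A := ⟨S.surjective_pinch.range_eq ▸ isCompact_range S.continuous_pinch⟩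
  have : ConnectedSpace A := S.surjective_pinch.connectedSpace S.continuous_pinch
  have : LocallyPathConnectedSpace A :=
    ChartedSpace.locallyPathConnectedSpace (EuclideanHalfSpace 3) A
  have : PathConnectedSpace A := pathConnectedSpace_iff_connectedSpace.mpr inferInstance
  obtain ⟨f, hf⟩ := exists_circleMap_not_three_nsmul A hA
  have : PreconnectedSpace (TripleCover f) := preconnectedSpace_tripleCover f hf
  have : ConnectedSpace B' := hq.connected
  have : T2Space B' := hq.isCoveringMap.t2Space
  obtain ⟨F, hF⟩ := exists_real_lift (f.comp ⟨S.ball, S.isOpenEmbedding.continuous⟩)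
  replace hF : ∀ z, (F z : UnitAddCircle) = f (S.ball z) := hF
  have hcard := hq.card_fiber (T.ball 0)
  have : Finite (q ⁻¹' {T.ball 0}) := Nat.finite_of_card_ne_zero (by omega)
  have hfin : (q ⁻¹' {T.ball 0}).Finite := Set.toFinite _
  obtain ⟨b₀, hb₀, b₁, hb₁, hb⟩ : (q ⁻¹' {T.ball 0}).Nontrivial := by
    rw [← Set.one_lt_ncard_iff_nontrivial, ← Nat.card_coe_set_eq]
    omega
  replace hb₀ : q b₀ = T.ball 0 := hb₀
  replace hb₁ : q b₁ = T.ball 0 := hb₁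
  -- the covering space
  have hp : IsCoveringMap fun w : PinchCover S T f q ↦ w.1.1 :=
    (isCoveringMap_three_nsmul.prodMap hq.isCoveringMap).pullback_fst
      ((f.continuous.comp S.continuous_pinch).prodMk T.continuous_pinch)
  have hT2 : T2Space (PinchCover S T f q) := hp.t2Space
  let _ : ChartedSpace (EuclideanHalfSpace 3) (PinchCover S T f q) :=
    hp.isLocalHomeomorph.pullbackChartedSpace
  have hM' : IsManifold (𝓡∂ 3) ∞ (PinchCover S T f q) :=
    hp.isLocalHomeomorph.isManifold_pullback (𝓡∂ 3)
  have hdiff : IsLocalDiffeomorph (𝓡∂ 3) (𝓡∂ 3) ∞ fun w : PinchCover S T f q ↦ w.1.1 :=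
    hp.isLocalHomeomorph.isLocalDiffeomorph_pullback (𝓡∂ 3)
  have : LocallyPathConnectedSpace (PinchCover S T f q) :=
    ChartedSpace.locallyPathConnectedSpace (EuclideanHalfSpace 3) _
  -- the circle maps dual to two of the lifted spheres
  let u (i : Fin 3) : C(PinchCover S T f q, UnitAddCircle) :=
    ⟨sphereClass hF b₀ i, continuous_sphereClass hF hTS hfin i⟩
  have h01 : HasTransversals (u 0) (u 1) :=
    hasTransversals_sphereClass hF hTS hb₀ (by decide) _ _ (fun _ ↦ rfl) fun _ ↦ rfl
  have h10 : HasTransversals (u 1) (u 0) :=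
    hasTransversals_sphereClass hF hTS hb₀ (by decide) _ _ (fun _ ↦ rfl) fun _ ↦ rfl
  have hO : IsConnected {w | u 0 w ≠ ((1 / 2 : ℝ) : UnitAddCircle) ∧
      u 1 w ≠ ((1 / 2 : ℝ) : UnitAddCircle)} :=
    isConnected_compl_spheres hF hq.isCoveringMap.continuous hTS hST hb₀ hb₁ hb.symm
  have hpre := preconnectedSpace_of_ne_half h01 h10 hO
  have hconn : ConnectedSpace (PinchCover S T f q) := { toNonempty := ⟨hO.nonempty.some⟩ }
  have : PathConnectedSpace (PinchCover S T f q) :=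
    pathConnectedSpace_iff_connectedSpace.mpr inferInstance
  obtain ⟨v⟩ : Nonempty S2 := (NormedSpace.sphere_nonempty.mpr zero_le_one).to_subtype
  refine ⟨PinchCover S T f q, inferInstance, inferInstance, fun w ↦ w.1.1, 3 * n,
    liftedSphere hF hTS hb₀ 0, hT2, hM',
    ⟨hconn, hp, by omega, card_fiber_pinchCover hq.card_fiber⟩, hdiff, ?_, ?_, ?_⟩
  · refine two_le_bettiOne_of_circleMaps (u 0) (u 1)
      ⟨_, sphereClass_liftedSphere hF hTS hb₀ 0 v⟩ ⟨_, sphereClass_liftedSphere hF hTS hb₀ 1 v⟩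
      h01 h10 ?_
    refine (IsOpen.isConnected_iff_isPathConnected ?_).mp hO
    exact (isOpen_ne_fun (u 0).continuous continuous_const).inter
      (isOpen_ne_fun (u 1).continuous continuous_const)
  · refine isEmbeddedSphere_of_lift hdiff (j := D.inclA ∘ D.ballA) (r := 3 / 2) (by norm_num)
      (fun v ↦ D.isLocalDiffeomorphAt_inclA_ballA ?_) ?_ (injective_liftedSphere hF hTS hb₀ 0)
      fun v ↦ rfl
    · rw [norm_smul, norm_eq_of_mem_sphere]
      norm_num
    · exact (continuous_collar hF hTS hb₀ 0).comp (by fun_prop)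
  · unfold IsNonseparating
    rw [range_liftedSphere]
    exact ⟨hO.nonempty.mono fun w hw ↦ hw.1, isPreconnected_ne_half h10 hO⟩
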